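/- Fix $p\in(0,1)$ and let $\omega=(\omega_v)_{v\in\mathbb Z_+^2}$ be i.i.d. Bernoulli weights under $\mathbb P$, with $\mathbb P\{\omega_v=1\}=p$ and $\mathbb P\{\omega_v=0\}=1-p$. An admissible path from $a$ to $b$ in $\mathbb Z_+^2$ is a finite sequence of sites $a=v_0,v_1,\dots,v_M=b$ with $v_{k+1}-v_k\in\{e_1,e_2,e_1+e_2\}$ for every $k$, and the last passage time is $$G_{a,b}=\max_{v_0,\dots,v_M}\ \sum_{k=0}^{M-1}\omega_{v_{k+1}}\,\mathbf 1\{v_{k+1}-v_k=e_1+e_2\},$$ the maximum being over all admissible paths from $a$ to $b$. Let $g_{pp}$ be the point-to-point shape function of the model, given by $$g_{pp}(s,t)=\begin{cases}s,& t\ge s/p,\\ \frac{1}{1-p}\big(2\sqrt{pst}-p(t+s)\big),& ps\le t<s/p,\\ t,& t\le ps.\end{cases}$$ Fix $x,y\in(0,\infty)$ such that $p<y/x<p^{-1}$. Then there exist finite constants $N_0$ and $C=C(x,y,p)>0$ such that, for all real $b\ge C$, all integers $N\ge N_0$ and any $0<\alpha<1$, $$\mathbb P\Big\{\big|G_{(1,1),(\lfloor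 Nx\rfloor,\lfloor Ny\rfloor)}-N g_{pp}(x,y)\big|\ge bN^{1/3}\Big\}\le C\,b^{-3\alpha/2}.$$ Moreover, for every $r\ge1$ there is a finite constant $C(x,y,p,r)$ such that, for every $\alpha\in(0,1)$ with $r<3\alpha/2$ and every integer $N>N_0$, $$\mathbb E\left[\left|\frac{G_{(1,1),(\lfloor Nx\rfloor,\lfloor Ny\rfloor)}-N g_{pp}(x,y)}{N^{1/3}}\right|^r\right]\le C(x,y,p,r)<\infty .$$ -/

import Mathlib

open MeasureTheory

/-- Sites of the quadrant `ℤ₊²`. -/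
abbrev Site : Type := ℕ × ℕ

/-- An environment assigns a real weight to every site. -/
abbrev Environment : Type := Site → ℝ

/-- The environment measure: i.i.d. weights with `P(ω_v = 1) = p` and `P(ω_v = 0) = 1 - p`. -/
noncomputable def envMeasure (p : unitInterval) : Measure Environment :=
  Measure.infinitePi fun _ : Site => ProbabilityTheory.bernoulliMeasure (1 : ℝ) (0 : ℝ) p

/-- The admissible steps `e₁`, `e₂` and `e₁ + e₂`. -/
def IsStep (v w : Site) : Prop :=
  w = v + (1, 0) ∨ w = v + (0, 1) ∨ w = v + (1, 1)

/-- `π` is an admissible path from `a` to `b`: an ordered sequence of sites that starts at `a`,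
ends at `b`, and moves by admissible steps. -/
def IsAdmissiblePath (a b : Site) (π : List Site) : Prop :=
  π.head? = some a ∧ π.getLast? = some b ∧ π.IsChain IsStep

/-- The weight collected by the move `v → w`: the weight at the endpoint `w` of a diagonal step,
and nothing for a horizontal or a vertical step. -/
def stepWeight (ω : Environment) (v w : Site) : ℝ :=
  if w = v + (1, 1) then ω w else 0

/-- The total weight collected along a path. -/
def pathWeight (ω : Environment) : List Site → ℝ
  | v :: w :: l => stepWeight ω v w + pathWeight ω (w :: l)
  | _ => 0

/-- The last passage time `G_{a,b}` in the environment `ω`, the maximum of the collected weight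
over the (finitely many) admissible paths from `a` to `b`. -/
noncomputable def lastPassage (a b : Site) (ω : Environment) : ℝ :=
  sSup {s : ℝ | ∃ π : List Site, IsAdmissiblePath a b π ∧ s = pathWeight ω π}

/-- The point-to-point shape function `g_pp` of the model with parameter `p`. -/
noncomputable def gpp (p s t : ℝ) : ℝ :=
  if s / p ≤ t then s
  else if p * s ≤ t then (2 * Real.sqrt (p * s * t) - p * (t + s)) / (1 - p)
  else t

/-- The last passage time `G_{(1,1),(⌊Nx⌋,⌊Ny⌋)}`. -/
noncomputable def bulkPassage (x y : ℝ) (N : ℕ) (ω : Environment) : ℝ :=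
  lastPassage (1, 1) (⌊(N : ℝ) * x⌋₊, ⌊(N : ℝ) * y⌋₊) ω

/-! The model has a stationary version: Bernoulli increments of parameter u on the bottom and v on
the left, with u v = p(1-u)(1-v). In log-odds this curve is a line, u = σ(θ) and v = σ(log p - θ)
(`sigmoid_stationary`), and Burke's property `wexp_topRow` says that the increments along the top
have the law of those along the bottom. The passage time is the left column plus the top row
(`lpp_eq_sum_topRow`), so tilting the left boundary gives the exact identity `wexp_exp_lpp`: with
horizontal parameter θ₁ and vertical parameter θ₂, E exp((θ₂-θ₁)G) = exp(L(θ₂)-L(θ₁)), where L is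
`logMoment`. The derivative of L is the stationary mean. Up to rounding, its minimum over θ is N
g_pp, attained quadratically at some θ₀ (`slope_eq_gpp_add`, `exists_slopeBounds`). Chernoff bounds
with parameters at distance of order h from θ₀ therefore control deviations of order N h² with
probability exp(-N h³).

The upper tail follows at once, since boundaries only increase the passage time. For the lower tail,
two slightly enriched boundaries (θ₀+h and θ₀-h) force the boundary model above Nμ₀ - N h²
(`SlopeBounds.boundary_lower_tail`), and a maximizing path leaves one boundary at some site
(`lpp_le_exit`). Leaving beyond order N h is too costly (`SlopeBounds.far_tail`). If it leaves
earlier while the bulk time is small, the boundary collects much more than the bulk gains across the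
same columns. Bulk increments dominate those of a vertical-boundary model (`lpp_increments`), and
these dominate stationary increments of parameter θ₀-Rh unless the horizontal boundary wins there,
which is unlikely (`SlopeBounds.horizontal_exit`). What remains is a maximal inequality for the
difference of two Bernoulli walks (`wexp_walk_max`), whose drift h over N h steps produces only N h²
(`SlopeBounds.near_tail`).

Taking N h² of order b N^{1/3} gives exp(-c b^{3/2}), which is weakened to K/b³. This beats every
b^{-3α/2} with α < 1 and bounds the required moments. All probability is carried out with finite
sums over bits and transferred to the infinite environment at the end. -/

/-! ### Finite Bernoulli expectations and indicators. -/

/-- The weight that a Bernoulli variable with success probability `q` gives to `b`. -/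
def bernWeight (q : ℝ) (b : Bool) : ℝ := if b then q else 1 - q

/-- The numerical value of a bit. -/
def bval (b : Bool) : ℝ := if b then 1 else 0

/-- Expectation of `f` with respect to the weights `w` on a finite type. -/
def wexp {α : Type*} [Fintype α] (w f : α → ℝ) : ℝ := ∑ a, w a * f a

/-- The product weight on configurations. -/
def prodWeight {ι α : Type*} [Fintype ι] (w : α → ℝ) (x : ι → α) : ℝ := ∏ i, w (x i)

/-- Probability weights on a finite type. -/
structure IsProbWeight {α : Type*} [Fintype α] (w : α → ℝ) : Prop where
  nonneg : ∀ a, 0 ≤ w a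
  sum_eq_one : ∑ a, w a = 1

open Classical in
/-- The indicator of a proposition. -/
noncomputable def ind (P : Prop) : ℝ := if P then 1 else 0

theorem ind_nonneg (P : Prop) : 0 ≤ ind P := by
  unfold ind; split_ifs <;> norm_num

theorem ind_le_one (P : Prop) : ind P ≤ 1 := by
  unfold ind; split_ifs <;> norm_num

theorem ind_of {P : Prop} (h : P) : ind P = 1 := by simp [ind, h]

theorem ind_of_not {P : Prop} (h : ¬ P) : ind P = 0 := by simp [ind, h]

theorem ind_le_of {P : Prop} {r : ℝ} (hr : 0 ≤ r) (h : P → 1 ≤ r) : ind P ≤ r := by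
  by_cases hP : P
  · rw [ind_of hP]; exact h hP
  · rwa [ind_of_not hP]

theorem ind_mono {P Q : Prop} (h : P → Q) : ind P ≤ ind Q :=
  ind_le_of (ind_nonneg Q) fun hP => (ind_of (h hP)).ge

theorem ind_le_exp {P : Prop} {r : ℝ} (h : P → 0 ≤ r) : ind P ≤ Real.exp r :=
  ind_le_of (Real.exp_pos _).le fun hP => Real.one_le_exp (h hP)

section Expectation

variable {α β : Type*} [Fintype α] [Fintype β] {w : α → ℝ} {w' : β → ℝ}

theorem wexp_comm (f : α → β → ℝ) :
    wexp w (fun a => wexp w' (f a)) = wexp w' (fun b => wexp w (fun a => f a b)) := by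
  simp only [wexp, Finset.mul_sum]
  rw [Finset.sum_comm]
  exact Finset.sum_congr rfl fun _ _ => Finset.sum_congr rfl fun _ _ => by ring

theorem wexp_add (f g : α → ℝ) : wexp w (fun a => f a + g a) = wexp w f + wexp w g := by
  simp only [wexp, mul_add, Finset.sum_add_distrib]

theorem wexp_const_mul (c : ℝ) (f : α → ℝ) : wexp w (fun a => c * f a) = c * wexp w f := by
  simp only [wexp, Finset.mul_sum]
  exact Finset.sum_congr rfl fun _ _ => by ring

theorem wexp_mul_const (f : α → ℝ) (c : ℝ) : wexp w (fun a => f a * c) = wexp w f * c := by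
  simp only [wexp, Finset.sum_mul]
  exact Finset.sum_congr rfl fun _ _ => by ring

theorem IsProbWeight.wexp_const (hw : IsProbWeight w) (c : ℝ) : wexp w (fun _ => c) = c := by
  simp only [wexp, ← Finset.sum_mul, hw.sum_eq_one, one_mul]

theorem IsProbWeight.wexp_mono (hw : IsProbWeight w) {f g : α → ℝ} (h : ∀ a, f a ≤ g a) :
    wexp w f ≤ wexp w g :=
  Finset.sum_le_sum fun a _ => mul_le_mul_of_nonneg_left (h a) (hw.nonneg a)

theorem IsProbWeight.wexp_le (hw : IsProbWeight w) {f : α → ℝ} {c : ℝ} (h : ∀ a, f a ≤ c) :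
    wexp w f ≤ c :=
  (hw.wexp_mono h).trans (hw.wexp_const c).le

theorem wexp_prod_zero (f : (Fin 0 → α) → ℝ) :
    wexp (prodWeight w) f = f (fun i => i.elim0) := by
  simp only [wexp, prodWeight, Finset.univ_unique, Finset.sum_singleton, Finset.univ_eq_empty,
    Finset.prod_empty, one_mul]
  exact congrArg f (Subsingleton.elim _ _)

theorem wexp_prod_succ {n : ℕ} (f : (Fin (n + 1) → α) → ℝ) :
    wexp (prodWeight w) f = wexp w fun a => wexp (prodWeight w) fun x => f (Fin.cons a x) := by
  simp only [wexp, prodWeight, Finset.mul_sum]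
  rw [← Fintype.sum_prod_type', ← (Fin.consEquiv fun _ : Fin (n + 1) => α).sum_comp]
  refine Finset.sum_congr rfl fun x _ => ?_
  change (∏ i, w ((Fin.cons x.1 x.2 : Fin (n + 1) → α) i)) * f (Fin.cons x.1 x.2) = _
  rw [Fin.prod_univ_succ, ← mul_assoc]
  rfl

theorem wexp_reindex {n : ℕ} (e : Equiv.Perm (Fin n)) (f : (Fin n → α) → ℝ) :
    wexp (prodWeight w) (fun x => f (fun i => x (e i))) = wexp (prodWeight w) f := by
  simp only [wexp, prodWeight]
  rw [← (Equiv.arrowCongr e.symm (Equiv.refl α)).sum_comp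
    fun x => (∏ i, w (x i)) * f x]
  refine Finset.sum_congr rfl fun x _ => ?_
  change _ = (∏ i, w (x (e i))) * f fun i => x (e i)
  rw [Equiv.prod_comp e fun i => w (x i)]

theorem wexp_transpose {m n : ℕ} (f : (Fin n → Fin m → α) → ℝ) :
    wexp (prodWeight (prodWeight w)) (fun x : Fin m → Fin n → α => f (fun j i => x i j)) =
      wexp (prodWeight (prodWeight w)) f := by
  simp only [wexp, prodWeight]
  rw [← (Equiv.piComm fun (_ : Fin m) (_ : Fin n) => α).sum_comp]
  refine Finset.sum_congr rfl fun x _ => ?_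
  congr 1
  rw [Finset.prod_comm]
  rfl

theorem IsProbWeight.prod {ι : Type*} [Fintype ι] [DecidableEq ι] (hw : IsProbWeight w) :
    IsProbWeight (prodWeight w : (ι → α) → ℝ) where
  nonneg x := Finset.prod_nonneg fun i _ => hw.nonneg _
  sum_eq_one := by
    simp only [prodWeight]
    rw [← Fintype.prod_sum fun (_ : ι) (a : α) => w a]
    simp [hw.sum_eq_one]

theorem wexp_congr {f g : α → ℝ} (h : ∀ a, f a = g a) : wexp w f = wexp w g := by
  rw [funext h]

end Expectation

theorem wexp_bern (q : ℝ) (f : Bool → ℝ) :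
    wexp (bernWeight q) f = q * f true + (1 - q) * f false := by
  simp [wexp, bernWeight]

theorem isProbWeight_bern {q : ℝ} (h0 : 0 ≤ q) (h1 : q ≤ 1) : IsProbWeight (bernWeight q) where
  nonneg b := by cases b <;> simp [bernWeight, h0, h1]
  sum_eq_one := by simp [bernWeight]

/-- Product Bernoulli expectations of nondecreasing functions increase with the parameter. -/
theorem wexp_bern_mono_param {q q' : ℝ} (h0 : 0 ≤ q) (hqq : q ≤ q') (h1 : q' ≤ 1) {n : ℕ}
    {f : (Fin n → Bool) → ℝ} (hf : Monotone f) :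
    wexp (prodWeight (bernWeight q)) f ≤ wexp (prodWeight (bernWeight q')) f := by
  induction n with
  | zero => simp only [wexp_prod_zero, le_refl]
  | succ n ih =>
    rw [wexp_prod_succ, wexp_prod_succ, wexp_bern, wexp_bern]
    have hc : ∀ b : Bool, Monotone fun x : Fin n → Bool => f (Fin.cons b x) := fun b x y h =>
      hf (Fin.cons_le_cons.2 ⟨le_rfl, h⟩)
    have ht := ih (hc true)
    have hfl := ih (hc false)
    have hq' : IsProbWeight (prodWeight (bernWeight q') : (Fin n → Bool) → ℝ) :=
      (isProbWeight_bern (h0.trans hqq) h1).prod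
    have hcmp : wexp (prodWeight (bernWeight q')) (fun x : Fin n → Bool => f (Fin.cons false x)) ≤
        wexp (prodWeight (bernWeight q')) (fun x : Fin n → Bool => f (Fin.cons true x)) :=
      hq'.wexp_mono fun x => hf (Fin.cons_le_cons.2 ⟨Bool.false_le _, le_rfl⟩)
    nlinarith [mul_le_mul_of_nonneg_left ht h0,
      mul_le_mul_of_nonneg_left hfl (by linarith : (0 : ℝ) ≤ 1 - q),
      mul_le_mul_of_nonneg_left hcmp (sub_nonneg.2 hqq)]

/-- The exponential moment of a sum of independent Bernoulli variables. -/
theorem wexp_bern_exp_sum (q t : ℝ) (n : ℕ) :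
    wexp (prodWeight (bernWeight q)) (fun x : Fin n → Bool => Real.exp (t * ∑ i, bval (x i))) =
      (1 - q + q * Real.exp t) ^ n := by
  induction n with
  | zero => simp [wexp_prod_zero]
  | succ n ih =>
    rw [wexp_prod_succ, wexp_bern]
    simp only [Fin.sum_univ_succ, Fin.cons_zero, Fin.cons_succ, mul_add, Real.exp_add,
      wexp_const_mul, ih]
    simp [bval, pow_succ]
    ring

/-! ### Deterministic last passage recursions: comparison, exit points, reversal. -/

/-- The last passage recursion with weights `w`, horizontal boundary values `S` and vertical
boundary values `V`. -/
def lpp (w : ℕ → ℕ → ℝ) (S V : ℕ → ℝ) : ℕ → ℕ → ℝ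
  | i, 0 => S i
  | 0, j + 1 => V (j + 1)
  | i + 1, j + 1 => max (max (lpp w S V i (j + 1)) (lpp w S V (i + 1) j)) (lpp w S V i j + w i j)

/-- The last passage recursion without boundary values. -/
def bulkLpp (w : ℕ → ℕ → ℝ) : ℕ → ℕ → ℝ := lpp w (fun _ => 0) (fun _ => 0)

/-- The weights translated by `z` columns. -/
def shiftCol (z : ℕ) (w : ℕ → ℕ → ℝ) : ℕ → ℕ → ℝ := fun i j => w (z + i) j

/-- The weights translated by `z` rows. -/
def shiftRow (z : ℕ) (w : ℕ → ℕ → ℝ) : ℕ → ℕ → ℝ := fun i j => w i (z + j)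

section Recursion

variable {w w' : ℕ → ℕ → ℝ} {S S' V V' : ℕ → ℝ}

@[simp] theorem lpp_zero_right (i : ℕ) : lpp w S V i 0 = S i := by
  cases i <;> simp [lpp]

theorem lpp_zero_left (h : S 0 = V 0) (j : ℕ) : lpp w S V 0 j = V j := by
  cases j <;> simp [lpp, h]

theorem lpp_succ (i j : ℕ) : lpp w S V (i + 1) (j + 1) =
    max (max (lpp w S V i (j + 1)) (lpp w S V (i + 1) j)) (lpp w S V i j + w i j) := by
  simp [lpp]

@[simp] theorem bulkLpp_zero_right (i : ℕ) : bulkLpp w i 0 = 0 := lpp_zero_right i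

@[simp] theorem bulkLpp_zero_left (j : ℕ) : bulkLpp w 0 j = 0 := lpp_zero_left rfl j

theorem bulkLpp_succ (i j : ℕ) : bulkLpp w (i + 1) (j + 1) =
    max (max (bulkLpp w i (j + 1)) (bulkLpp w (i + 1) j)) (bulkLpp w i j + w i j) :=
  lpp_succ i j

theorem lpp_congr {m n : ℕ} (hw : ∀ i < m, ∀ j < n, w i j = w' i j)
    (hS : ∀ i ≤ m, S i = S' i) (hV : ∀ j ≤ n, V j = V' j) : lpp w S V m n = lpp w' S' V' m n := by
  induction m generalizing n with
  | zero =>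
    cases n with
    | zero => simpa using hS 0 le_rfl
    | succ n => simpa [lpp] using hV _ le_rfl
  | succ m ihm =>
    induction n with
    | zero => simpa using hS _ le_rfl
    | succ n ihn =>
      rw [lpp_succ, lpp_succ,
        ihm (fun i hi j hj => hw i (by omega) j hj) (fun i hi => hS i (by omega)) hV,
        ihn (fun i hi j hj => hw i hi j (by omega)) (fun j hj => hV j (by omega)),
        ihm (n := n) (fun i hi j hj => hw i (by omega) j (by omega)) (fun i hi => hS i (by omega))
          (fun j hj => hV j (by omega)), hw m (by omega) n (by omega)]

theorem bulkLpp_congr {m n : ℕ} (hw : ∀ i < m, ∀ j < n, w i j = w' i j) :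
    bulkLpp w m n = bulkLpp w' m n :=
  lpp_congr hw (fun _ _ => rfl) fun _ _ => rfl

theorem lpp_transpose (h : S 0 = V 0) (i j : ℕ) :
    lpp (fun i j => w j i) V S j i = lpp w S V i j := by
  induction i generalizing j with
  | zero => rw [lpp_zero_left h, lpp_zero_right]
  | succ i ihi =>
    induction j with
    | zero => rw [lpp_zero_right, lpp_zero_left h.symm]
    | succ j ihj => rw [lpp_succ, lpp_succ, ihi, ihj, ihi, max_comm (lpp w S V (i + 1) j)]

theorem bulkLpp_transpose (i j : ℕ) : bulkLpp (fun i j => w j i) j i = bulkLpp w i j :=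
  lpp_transpose rfl i j

theorem lpp_mono (hS : ∀ i, S i ≤ S' i) (hV : ∀ j, V j ≤ V' j) (i j : ℕ) :
    lpp w S V i j ≤ lpp w S' V' i j := by
  induction i generalizing j with
  | zero => cases j <;> simp [lpp, hS, hV]
  | succ i ihi =>
    induction j with
    | zero => simpa using hS _
    | succ j ihj =>
      rw [lpp_succ, lpp_succ]
      exact max_le_max (max_le_max (ihi _) ihj) (add_le_add_left (ihi _) _)

theorem bulkLpp_le_lpp (hS : ∀ i, 0 ≤ S i) (hV : ∀ j, 0 ≤ V j) (i j : ℕ) :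
    bulkLpp w i j ≤ lpp w S V i j :=
  lpp_mono hS hV i j

theorem bulkLpp_nonneg (i j : ℕ) : 0 ≤ bulkLpp w i j := by
  induction i generalizing j with
  | zero => simp
  | succ i ihi =>
    cases j with
    | zero => simp
    | succ j =>
      rw [bulkLpp_succ]
      exact (ihi (j + 1)).trans ((le_max_left _ _).trans (le_max_left _ _))

theorem bulkLpp_le (hw : ∀ i j, w i j ≤ 1) (i j : ℕ) : bulkLpp w i j ≤ i := by
  induction i generalizing j with
  | zero => simp
  | succ i ihi =>
    induction j with
    | zero => simp; positivity
    | succ j ihj =>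
      rw [bulkLpp_succ]
      push_cast at ihj ⊢
      have h1 := ihi (j + 1)
      have h2 := ihi j
      have h3 := hw i j
      exact max_le (max_le (by linarith) ihj) (by linarith)

/-- The passage time with two boundaries is the maximum of those with one of them. -/
theorem lpp_eq_max (hS : ∀ i, 0 ≤ S i) (hV : ∀ j, 0 ≤ V j) (h0 : S 0 = 0) (h0' : V 0 = 0)
    (i j : ℕ) :
    lpp w S V i j = max (lpp w S (fun _ => 0) i j) (lpp w (fun _ => 0) V i j) := by
  induction i generalizing j with
  | zero =>
    rw [lpp_zero_left (h0.trans h0'.symm), lpp_zero_left h0, lpp_zero_left h0'.symm]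
    exact (max_eq_right (hV j)).symm
  | succ i ihi =>
    induction j with
    | zero => simp [hS]
    | succ j ihj =>
      simp only [lpp_succ, ihi, ihj, max_add]
      simp only [max_comm, max_left_comm]

/-- A vertical boundary decreases horizontal increments and increases vertical ones. -/
theorem lpp_increments (hV : Monotone V) (h0 : V 0 = 0) (i j : ℕ) :
    lpp w (fun _ => 0) V (i + 1) j - lpp w (fun _ => 0) V i j ≤
        bulkLpp w (i + 1) j - bulkLpp w i j ∧
      bulkLpp w i (j + 1) - bulkLpp w i j ≤
        lpp w (fun _ => 0) V i (j + 1) - lpp w (fun _ => 0) V i j := by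
  -- One cell: with increments I below, J to the left and weight w, the outgoing increments are
  -- max(0, I-J, w-J) above and max(0, J-I, w-I) to the right. Lowering I and raising J therefore
  -- propagates through the cell.
  have hrow : ∀ i j, (lpp w (fun _ => 0) V (i + 1) j - lpp w (fun _ => 0) V i j ≤
      bulkLpp w (i + 1) j - bulkLpp w i j) → (bulkLpp w i (j + 1) - bulkLpp w i j ≤
        lpp w (fun _ => 0) V i (j + 1) - lpp w (fun _ => 0) V i j) →
      (lpp w (fun _ => 0) V (i + 1) (j + 1) - lpp w (fun _ => 0) V i (j + 1) ≤
      bulkLpp w (i + 1) (j + 1) - bulkLpp w i (j + 1)) ∧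
      (bulkLpp w (i + 1) (j + 1) - bulkLpp w (i + 1) j ≤
        lpp w (fun _ => 0) V (i + 1) (j + 1) - lpp w (fun _ => 0) V (i + 1) j) := by
    intro i j hI hJ
    rw [lpp_succ, bulkLpp_succ]
    constructor
    · rcases max_choice (max (lpp w (fun _ => 0) V i (j + 1)) (lpp w (fun _ => 0) V (i + 1) j))
        (lpp w (fun _ => 0) V i j + w i j) with h | h <;> rw [h]
      · rcases max_choice (lpp w (fun _ => 0) V i (j + 1)) (lpp w (fun _ => 0) V (i + 1) j)
          with h | h <;> rw [h]
        · have := le_max_left (max (bulkLpp w i (j + 1)) (bulkLpp w (i + 1) j))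
            (bulkLpp w i j + w i j)
          have := le_max_left (bulkLpp w i (j + 1)) (bulkLpp w (i + 1) j)
          linarith
        · have := le_max_left (max (bulkLpp w i (j + 1)) (bulkLpp w (i + 1) j))
            (bulkLpp w i j + w i j)
          have := le_max_right (bulkLpp w i (j + 1)) (bulkLpp w (i + 1) j)
          linarith
      · have := le_max_right (max (bulkLpp w i (j + 1)) (bulkLpp w (i + 1) j))
            (bulkLpp w i j + w i j)
        linarith
    · rcases max_choice (max (bulkLpp w i (j + 1)) (bulkLpp w (i + 1) j))
            (bulkLpp w i j + w i j) with h | h <;> rw [h]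
      · rcases max_choice (bulkLpp w i (j + 1)) (bulkLpp w (i + 1) j) with h | h <;> rw [h]
        · have := le_max_left (max (lpp w (fun _ => 0) V i (j + 1))
            (lpp w (fun _ => 0) V (i + 1) j)) (lpp w (fun _ => 0) V i j + w i j)
          have := le_max_left (lpp w (fun _ => 0) V i (j + 1)) (lpp w (fun _ => 0) V (i + 1) j)
          linarith
        · have := le_max_left (max (lpp w (fun _ => 0) V i (j + 1))
            (lpp w (fun _ => 0) V (i + 1) j)) (lpp w (fun _ => 0) V i j + w i j)
          have := le_max_right (lpp w (fun _ => 0) V i (j + 1)) (lpp w (fun _ => 0) V (i + 1) j)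
          linarith
      · have := le_max_right (max (lpp w (fun _ => 0) V i (j + 1))
            (lpp w (fun _ => 0) V (i + 1) j)) (lpp w (fun _ => 0) V i j + w i j)
        linarith
  induction i generalizing j with
  | zero =>
    have hJ : ∀ j, bulkLpp w 0 (j + 1) - bulkLpp w 0 j ≤
        lpp w (fun _ => 0) V 0 (j + 1) - lpp w (fun _ => 0) V 0 j := fun j => by
      rw [lpp_zero_left h0.symm, lpp_zero_left h0.symm]
      simpa using hV (Nat.le_succ j)
    refine ⟨?_, hJ j⟩
    induction j with
    | zero => simp
    | succ j ihj => exact (hrow 0 j ihj (hJ j)).1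
  | succ i ihi =>
    have hI : ∀ j, lpp w (fun _ => 0) V (i + 1 + 1) j - lpp w (fun _ => 0) V (i + 1) j ≤
        bulkLpp w (i + 1 + 1) j - bulkLpp w (i + 1) j := fun j => by
      induction j with
      | zero => simp
      | succ j ihj => exact (hrow (i + 1) j ihj (hrow i j (ihi j).1 (ihi j).2).2).1
    exact ⟨hI j, (hrow i j (ihi j).1 (ihi j).2).2⟩

theorem lpp_increment_le (hV : Monotone V) (h0 : V 0 = 0) (i z j : ℕ) :
    lpp w (fun _ => 0) V (i + z) j - lpp w (fun _ => 0) V i j ≤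
      bulkLpp w (i + z) j - bulkLpp w i j := by
  induction z with
  | zero => simp
  | succ z ih =>
    have := (lpp_increments (w := w) hV h0 (i + z) j).1
    rw [← add_assoc]
    linarith

/-- Leaving the horizontal boundary at `z` is one of the options. -/
theorem add_bulkLpp_le_lpp (hS : Monotone S) (hV : ∀ j, 0 ≤ V j) (h0 : S 0 = 0) (z i j : ℕ) :
    S z + bulkLpp (shiftCol z w) i j ≤ lpp w S V (z + i) j := by
  have hz : ∀ j, S z ≤ lpp w S V z j := fun j => by
    induction j with
    | zero => simp
    | succ j ih =>
      cases z with
      | zero => simpa [lpp, h0] using hV _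
      | succ z =>
        rw [lpp_succ]
        exact ih.trans ((le_max_right _ _).trans (le_max_left _ _))
  induction i generalizing j with
  | zero => simpa using hz j
  | succ i ihi =>
    induction j with
    | zero => simpa using hS (by omega)
    | succ j ihj =>
      rw [bulkLpp_succ, ← add_assoc, lpp_succ, ← max_add_add_left, ← max_add_add_left]
      refine max_le_max (max_le_max (ihi _) ihj) ?_
      rw [← add_assoc]
      exact add_le_add_left (ihi j) _

/-- A maximizing path leaves one of the two boundaries somewhere. -/
theorem lpp_le_exit (h0 : S 0 = 0) (h0' : V 0 = 0) (i j : ℕ) :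
    (∃ z ≤ i, lpp w S V i j ≤ S z + bulkLpp (shiftCol z w) (i - z) j) ∨
      ∃ z ≤ j, lpp w S V i j ≤ V z + bulkLpp (shiftRow z w) i (j - z) := by
  induction i generalizing j with
  | zero => exact Or.inr ⟨j, le_rfl, by simp [lpp_zero_left (h0.trans h0'.symm)]⟩
  | succ i ihi =>
    induction j with
    | zero => exact Or.inl ⟨i + 1, le_rfl, by simp⟩
    | succ j ihj =>
      rw [lpp_succ]
      rcases max_choice (max (lpp w S V i (j + 1)) (lpp w S V (i + 1) j))
        (lpp w S V i j + w i j) with h | h <;> rw [h]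
      · rcases max_choice (lpp w S V i (j + 1)) (lpp w S V (i + 1) j) with h | h <;> rw [h]
        · rcases ihi (j + 1) with ⟨z, hz, h⟩ | ⟨z, hz, h⟩
          · refine Or.inl ⟨z, by omega, h.trans (add_le_add_right ?_ _)⟩
            rw [show i + 1 - z = i - z + 1 by omega, bulkLpp_succ]
            exact (le_max_left _ _).trans (le_max_left _ _)
          · refine Or.inr ⟨z, hz, h.trans (add_le_add_right ?_ _)⟩
            rcases Nat.eq_zero_or_pos (j + 1 - z) with h0 | h0
            · simp [h0]
            · rw [show j + 1 - z = j - z + 1 by omega, bulkLpp_succ]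
              exact (le_max_left _ _).trans (le_max_left _ _)
        · rcases ihj with ⟨z, hz, h⟩ | ⟨z, hz, h⟩
          · refine Or.inl ⟨z, hz, h.trans (add_le_add_right ?_ _)⟩
            rcases Nat.eq_zero_or_pos (i + 1 - z) with h0 | h0
            · simp [h0]
            · rw [show i + 1 - z = i - z + 1 by omega, bulkLpp_succ]
              exact (le_max_right _ _).trans (le_max_left _ _)
          · refine Or.inr ⟨z, by omega, h.trans (add_le_add_right ?_ _)⟩
            rw [show j + 1 - z = j - z + 1 by omega, bulkLpp_succ]
            exact (le_max_right _ _).trans (le_max_left _ _)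
      · rcases ihi j with ⟨z, hz, h⟩ | ⟨z, hz, h⟩
        · refine Or.inl ⟨z, by omega, (add_le_add_left h _).trans ?_⟩
          rw [add_assoc]
          refine add_le_add_right ?_ _
          rw [show i + 1 - z = i - z + 1 by omega, bulkLpp_succ]
          refine le_trans ?_ (le_max_right _ _)
          simp only [shiftCol]
          rw [show z + (i - z) = i by omega]
        · refine Or.inr ⟨z, by omega, (add_le_add_left h _).trans ?_⟩
          rw [add_assoc]
          refine add_le_add_right ?_ _
          rw [show j + 1 - z = j - z + 1 by omega, bulkLpp_succ]
          refine le_trans ?_ (le_max_right _ _)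
          simp only [shiftRow]
          rw [show z + (j - z) = j by omega]

/-- The recursion with respect to the starting point. -/
theorem bulkLpp_start (hw : ∀ i j, 0 ≤ w i j) (i j : ℕ) :
    bulkLpp w (i + 1) (j + 1) = max (max (bulkLpp (shiftCol 1 w) i (j + 1))
      (bulkLpp (shiftRow 1 w) (i + 1) j))
      (bulkLpp (shiftCol 1 (shiftRow 1 w)) i j + w 0 0) := by
  induction i generalizing j w with
  | zero =>
    induction j generalizing w with
    | zero => simp [bulkLpp_succ]
    | succ j ih =>
      rw [bulkLpp_succ, ih hw, bulkLpp_succ (w := shiftRow 1 w)]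
      simp only [bulkLpp_zero_left, zero_add]
      have h2 : w 0 (j + 1) = shiftRow 1 w 0 j := by simp [shiftRow, add_comm]
      rw [h2]
      have h3 := bulkLpp_nonneg (w := shiftRow 1 w) 1 j
      rw [max_eq_right h3]
      ac_rfl
  | succ i ihi =>
    induction j with
    | zero =>
      rw [bulkLpp_succ, ihi hw, bulkLpp_succ (w := shiftCol 1 w)]
      simp only [bulkLpp_zero_right, zero_add]
      have h2 : w (i + 1) 0 = shiftCol 1 w i 0 := by simp [shiftCol, add_comm]
      rw [h2]
      have h3 := bulkLpp_nonneg (w := shiftCol 1 w) i 1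
      rw [max_eq_left h3]
      ac_rfl
    | succ j ihj =>
      rw [bulkLpp_succ, ihj, ihi hw, ihi hw, bulkLpp_succ (w := shiftCol 1 w) i (j + 1),
        bulkLpp_succ (w := shiftRow 1 w) (i + 1) j,
        bulkLpp_succ (w := shiftCol 1 (shiftRow 1 w)) i j]
      have h1 : w (i + 1) (j + 1) = shiftCol 1 w i (j + 1) := by simp [shiftCol, add_comm]
      have h2 : shiftRow 1 w (i + 1) j = shiftCol 1 w i (j + 1) := by
        simp [shiftCol, shiftRow, add_comm]
      have h3 : shiftCol 1 (shiftRow 1 w) i j = shiftCol 1 w i (j + 1) := by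
        simp [shiftCol, shiftRow, add_comm]
      rw [h1, h2, h3]
      simp only [← max_add_add_right, add_right_comm _ (w 0 0)]
      generalize bulkLpp (shiftCol 1 (shiftRow 1 w)) i j + shiftCol 1 w i (j + 1) + w 0 0 = c
      ac_rfl

/-- Reversing the weights in a rectangle does not change its passage time. -/
theorem bulkLpp_reverse (hw : ∀ i j, 0 ≤ w i j) (m n : ℕ) :
    bulkLpp (fun i j => w (m - 1 - i) (n - 1 - j)) m n = bulkLpp w m n := by
  induction m generalizing n w with
  | zero => simp
  | succ m ihm =>
    induction n generalizing w with
    | zero => simp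
    | succ n ihn =>
      rw [bulkLpp_succ, bulkLpp_start hw, ← ihm (w := shiftCol 1 w) (fun _ _ => hw _ _),
        ← ihn (w := shiftRow 1 w) (fun _ _ => hw _ _),
        ← ihm (w := shiftCol 1 (shiftRow 1 w)) (fun _ _ => hw _ _)]
      congr 1
      · congr 1
        · exact bulkLpp_congr fun i hi j hj => by
            simp only [shiftCol]; congr 1; omega
        · exact bulkLpp_congr fun i hi j hj => by
            simp only [shiftRow]; congr 1; omega
      · congr 1
        · exact bulkLpp_congr fun i hi j hj => by
            simp only [shiftRow, shiftCol]; congr 1 <;> omega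
        · congr 1 <;> omega

end Recursion

/-! ### Boundaries and weights built from finitely many bits. -/

/-- Expectation over independent Bernoulli variables. -/
abbrev bernExp (q : ℝ) {n : ℕ} (f : (Fin n → Bool) → ℝ) : ℝ := wexp (prodWeight (bernWeight q)) f

/-- Expectation over a rectangle of independent Bernoulli variables. -/
abbrev bulkExp (p : ℝ) {m n : ℕ} (f : (Fin m → Fin n → Bool) → ℝ) : ℝ :=
  wexp (prodWeight (prodWeight (bernWeight p))) f

/-- Partial sums of a sequence of bits. -/
def psum {m : ℕ} (s : Fin m → Bool) (i : ℕ) : ℝ := ∑ k : Fin m, if (k : ℕ) < i then bval (s k) else 0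

/-- Weights given by a rectangle of bits. -/
def wt {m n : ℕ} (x : Fin m → Fin n → Bool) (i j : ℕ) : ℝ :=
  if h : i < m ∧ j < n then bval (x ⟨i, h.1⟩ ⟨j, h.2⟩) else 0

theorem bval_nonneg (b : Bool) : 0 ≤ bval b := by cases b <;> simp [bval]

theorem bval_le_one (b : Bool) : bval b ≤ 1 := by cases b <;> simp [bval]

section Extension

variable {m n : ℕ}

@[simp] theorem psum_zero (s : Fin m → Bool) : psum s 0 = 0 := by simp [psum]

theorem psum_succ (s : Fin (m + 1) → Bool) (i : ℕ) :
    psum s (i + 1) = bval (s 0) + psum (Fin.tail s) i := by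
  simp [psum, Fin.sum_univ_succ, Fin.tail]

theorem psum_cons_succ (b : Bool) (s : Fin m → Bool) (i : ℕ) :
    psum (Fin.cons b s : Fin (m + 1) → Bool) (i + 1) = bval b + psum s i := by
  rw [psum_succ, Fin.tail_cons, Fin.cons_zero]

theorem psum_full (s : Fin m → Bool) : psum s m = ∑ k, bval (s k) := by simp [psum]

theorem psum_mono (s : Fin m → Bool) : Monotone (psum s) := fun i j h =>
  Finset.sum_le_sum fun k _ => by
    split_ifs
    · exact le_rfl
    · omega
    · exact bval_nonneg _
    · exact le_rfl

theorem psum_nonneg (s : Fin m → Bool) (i : ℕ) : 0 ≤ psum s i :=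
  (psum_zero s).ge.trans (psum_mono s (Nat.zero_le i))

theorem psum_le_psum {s s' : Fin m → Bool} (h : s ≤ s') (i : ℕ) : psum s i ≤ psum s' i :=
  Finset.sum_le_sum fun k _ => by
    split_ifs
    · have := h k
      revert this
      cases s k <;> cases s' k <;> simp [bval]
    · exact le_rfl

theorem psum_step (s : Fin m → Bool) (i : ℕ) (h : i < m) :
    psum s (i + 1) = psum s i + bval (s ⟨i, h⟩) := by
  induction m generalizing i with
  | zero => omega
  | succ m ih =>
    cases i with
    | zero => simp [psum_succ]
    | succ i =>
      rw [psum_succ, psum_succ, ih (Fin.tail s) i (by omega), add_assoc]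
      rfl

theorem wt_nonneg (x : Fin m → Fin n → Bool) (i j : ℕ) : 0 ≤ wt x i j := by
  unfold wt; split_ifs
  · exact bval_nonneg _
  · exact le_rfl

theorem wt_le_one (x : Fin m → Fin n → Bool) (i j : ℕ) : wt x i j ≤ 1 := by
  unfold wt; split_ifs
  · exact bval_le_one _
  · exact zero_le_one

theorem wt_succ (x : Fin (m + 1) → Fin n → Bool) (i j : ℕ) :
    wt x (i + 1) j = wt (Fin.tail x) i j := by
  simp [wt, Fin.tail]

end Extension

/-! ### The stationary model and Burke's property. -/

section Burke

/-- The horizontal increment above a cell, given the horizontal increment `b` below it, the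
vertical increment `c` to its left, and its weight `w`. -/
def cellH (b c w : Bool) : Bool := if b = c then !b && w else b

/-- The vertical increment to the right of a cell. -/
def cellV (b c w : Bool) : Bool := if b = c then !b && w else c

/-- The gain across the cell can be read along its left and top sides or along its bottom and right
sides; this identifies `cellH` and `cellV` as the outgoing increments. -/
theorem cell_spec (b c w : Bool) :
    max (max (bval c) (bval b)) (bval w) = bval c + bval (cellH b c w) ∧
      max (max (bval c) (bval b)) (bval w) = bval b + bval (cellV b c w) := by
  cases b <;> cases c <;> cases w <;> simp [bval, cellH, cellV]

/-- The stationary cell: the map of increments preserves the product law. -/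
theorem wexp_cell {u v p : ℝ} (h : u * v = p * ((1 - u) * (1 - v))) (f : Bool → Bool → ℝ) :
    wexp (bernWeight u) (fun b => wexp (bernWeight v) fun c => wexp (bernWeight p) fun w =>
      f (cellH b c w) (cellV b c w)) =
    wexp (bernWeight u) (fun b => wexp (bernWeight v) fun c => f b c) := by
  simp only [wexp_bern, cellH, cellV]
  simp
  -- Unequal increments pass through unchanged and (1,1) becomes (0,0), while (0,0) becomes (1,1)
  -- exactly when the weight is 1. Stationarity is thus the single mass balance u v = p(1-u)(1-v).
  linear_combination (f false false - f true true) * h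

/-- The vertical increments to the right of a column, and the horizontal increment above it. -/
def colStep : (n : ℕ) → (Fin n → Bool) → (Fin n → Bool) → Bool → (Fin n → Bool) × Bool
  | 0, v, _, b => (v, b)
  | n + 1, v, w, b =>
    (Fin.cons (cellV b (v 0) (w 0)) (colStep n (Fin.tail v) (Fin.tail w) (cellH b (v 0) (w 0))).1,
      (colStep n (Fin.tail v) (Fin.tail w) (cellH b (v 0) (w 0))).2)

/-- The horizontal increments along the top row. -/
def topRow {n : ℕ} : (m : ℕ) → (Fin m → Fin n → Bool) → (Fin m → Bool) → (Fin n → Bool) →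
    (Fin m → Bool)
  | 0, _, s, _ => s
  | m + 1, x, s, v =>
    Fin.cons (colStep n v (x 0) (s 0)).2
      (topRow m (Fin.tail x) (Fin.tail s) (colStep n v (x 0) (s 0)).1)

/-- The horizontal increment is pushed upward through the column: after each cell it is again
independent of the vertical increment just produced, so `wexp_cell` applies to the next one. -/
theorem wexp_colStep {u v p : ℝ} (h : u * v = p * ((1 - u) * (1 - v))) {n : ℕ}
    (f : (Fin n → Bool) → Bool → ℝ) :
    wexp (bernWeight u) (fun b => bernExp v fun c => bernExp p fun w =>
      f (colStep n c w b).1 (colStep n c w b).2) =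
    wexp (bernWeight u) (fun b => bernExp v fun c => f c b) := by
  induction n with
  | zero => simp only [wexp_prod_zero, colStep]
  | succ n ih =>
    calc _ = wexp (bernWeight u) (fun b => wexp (bernWeight v) fun c0 =>
          wexp (bernWeight p) fun w0 => bernExp v fun c => bernExp p fun w =>
            f (Fin.cons (cellV b c0 w0) (colStep n c w (cellH b c0 w0)).1)
              (colStep n c w (cellH b c0 w0)).2) := by
          simp only [bernExp]
          refine wexp_congr fun b => ?_
          rw [wexp_prod_succ]
          refine wexp_congr fun c0 => ?_
          simp only [wexp_prod_succ (w := bernWeight p)]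
          rw [wexp_comm]
          rfl
      _ = wexp (bernWeight u) (fun b => wexp (bernWeight v) fun c0 =>
            bernExp v fun c => bernExp p fun w =>
            f (Fin.cons c0 (colStep n c w b).1) (colStep n c w b).2) :=
          wexp_cell h fun b c0 => bernExp v fun c => bernExp p fun w =>
            f (Fin.cons c0 (colStep n c w b).1) (colStep n c w b).2
      _ = _ := by
          rw [wexp_comm]
          have ih' := fun c0 => ih fun c b => f (Fin.cons c0 c) b
          simp only [ih']
          rw [wexp_comm]
          refine wexp_congr fun b => ?_
          rw [bernExp, wexp_prod_succ]

/-- Burke's property: in the stationary model the increments along the top row have the same law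
as those along the bottom row. -/
theorem wexp_topRow {u v p : ℝ} (h : u * v = p * ((1 - u) * (1 - v)))
    (hp : IsProbWeight (bernWeight p)) (hv : IsProbWeight (bernWeight v)) {m n : ℕ}
    (f : (Fin m → Bool) → ℝ) :
    bernExp u (fun s => bernExp v fun c : Fin n → Bool => bulkExp p fun x =>
      f (topRow m x s c)) = bernExp u f := by
  induction m with
  | zero =>
    simp only [topRow]
    exact wexp_congr fun s => (hv.prod.wexp_le fun c => (hp.prod.prod.wexp_const _).le).antisymm
      ((hv.prod.wexp_const _).ge.trans (hv.prod.wexp_mono fun c => (hp.prod.prod.wexp_const _).ge))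
  | succ m ih =>
    calc _ = wexp (bernWeight u) (fun b => bernExp v fun c : Fin n → Bool =>
          bernExp p fun w : Fin n → Bool => bernExp u fun s => bulkExp p fun x =>
            f (Fin.cons (colStep n c w b).2 (topRow m x s (colStep n c w b).1))) := by
          simp only [bernExp, bulkExp]
          rw [wexp_prod_succ]
          refine wexp_congr fun b => ?_
          rw [wexp_comm]
          refine wexp_congr fun c => ?_
          simp only [wexp_prod_succ (w := prodWeight (bernWeight p))]
          rw [wexp_comm]
          rfl
      _ = wexp (bernWeight u) (fun b => bernExp v fun c : Fin n → Bool =>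
            bernExp u fun s => bulkExp p fun x => f (Fin.cons b (topRow m x s c))) :=
          wexp_colStep h fun c b => bernExp u fun s => bulkExp p fun x =>
            f (Fin.cons b (topRow m x s c))
      _ = _ := by
          simp only [bernExp, bulkExp] at ih ⊢
          rw [wexp_prod_succ]
          refine wexp_congr fun b => ?_
          rw [wexp_comm, ih fun s => f (Fin.cons b s)]

end Burke

/-! ### The passage time as a sum of increments. -/

section Increments

/-- `X` and `Y` are the passage times on the left and right sides of one column. Only their
differences enter, so the induction can move the base point up one cell. -/
theorem column_sequence {n : ℕ} (v w : Fin n → Bool) (b : Bool) (X Y : ℕ → ℝ)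
    (hX : ∀ j : Fin n, X (j + 1) = X j + bval (v j)) (hY0 : Y 0 = X 0 + bval b)
    (hY : ∀ j : Fin n, Y (j + 1) = max (max (X (j + 1)) (Y j)) (X j + bval (w j))) :
    (∀ j ≤ n, Y j = Y 0 + psum (colStep n v w b).1 j) ∧
      Y n = X n + bval (colStep n v w b).2 := by
  induction n generalizing b X Y with
  | zero => exact ⟨fun j hj => by simp [Nat.le_zero.1 hj], hY0⟩
  | succ n ih =>
    have h1 : Y 1 = X 0 + max (max (bval (v 0)) (bval b)) (bval (w 0)) := by
      have h := hY 0
      have h' := hX 0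
      simp only [Fin.val_zero, zero_add] at h h'
      rw [h, h', hY0, max_add_add_left, max_add_add_left]
    obtain ⟨hH, hV⟩ := cell_spec b (v 0) (w 0)
    have hX0 : X 1 = X 0 + bval (v 0) := hX 0
    obtain ⟨h2, h3⟩ := ih (Fin.tail v) (Fin.tail w) (cellH b (v 0) (w 0)) (fun j => X (j + 1))
      (fun j => Y (j + 1)) (fun j => hX j.succ) (by simp only [zero_add]; rw [h1, hH, hX0, add_assoc])
      (fun j => hY j.succ)
    refine ⟨fun j hj => ?_, h3⟩
    cases j with
    | zero => simp
    | succ j =>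
      rw [h2 j (by omega), colStep, psum_cons_succ, zero_add, h1, hV, hY0]
      ring

/-- Once the first column is processed, the rest is a boundary model of the same kind whose vertical
boundary is the output of that column. -/
theorem lpp_first_column {m n : ℕ} (x : Fin (m + 1) → Fin n → Bool) (s : Fin (m + 1) → Bool)
    (v : Fin n → Bool) (i : ℕ) {j : ℕ} (hj : j ≤ n) :
    lpp (wt x) (psum s) (psum v) (i + 1) j = bval (s 0) +
      lpp (wt (Fin.tail x)) (psum (Fin.tail s)) (psum (colStep n v (x 0) (s 0)).1) i j := by
  induction i generalizing j with
  | zero =>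
    have h := (column_sequence v (x 0) (s 0) (psum v) (fun j => lpp (wt x) (psum s) (psum v) 1 j)
      (fun j => psum_step v j j.2) (by simp [psum_succ]) (fun j => by
        rw [lpp_succ, lpp_zero_left (by simp), lpp_zero_left (by simp)]
        simp [wt])).1 j hj
    simp only [lpp_zero_right] at h
    rw [zero_add, h, lpp_zero_left (by simp), psum_succ]
    simp
  | succ i ihi =>
    induction j with
    | zero => simp [psum_succ]
    | succ j ihj =>
      rw [lpp_succ, ihi hj, ihj (by omega), ihi (by omega), lpp_succ, wt_succ, max_add_add_left,
        add_assoc, max_add_add_left]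

/-- Conservation: both ways around the column join the same two corners. -/
theorem sum_colStep {n : ℕ} (v w : Fin n → Bool) (b : Bool) :
    bval b + ∑ j, bval ((colStep n v w b).1 j) = (∑ j, bval (v j)) + bval (colStep n v w b).2 := by
  induction n generalizing b with
  | zero => simp [colStep]
  | succ n ih =>
    obtain ⟨hH, hV⟩ := cell_spec b (v 0) (w 0)
    have := ih (Fin.tail v) (Fin.tail w) (cellH b (v 0) (w 0))
    simp only [colStep, Fin.sum_univ_succ, Fin.cons_zero, Fin.cons_succ]
    simp only [Fin.tail] at this ⊢
    linarith

/-- The passage time is the sum of the increments along the left column and the top row. -/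
theorem lpp_eq_sum_topRow {m n : ℕ} (x : Fin m → Fin n → Bool) (s : Fin m → Bool)
    (v : Fin n → Bool) {z : ℕ} (hz : z ≤ m) :
    lpp (wt x) (psum s) (psum v) z n = (∑ j, bval (v j)) + psum (topRow m x s v) z := by
  induction m generalizing v z with
  | zero => rw [Nat.le_zero.1 hz, lpp_zero_left (by simp), psum_full]; simp
  | succ m ih =>
    cases z with
    | zero => rw [lpp_zero_left (by simp), psum_full]; simp
    | succ z =>
      rw [lpp_first_column x s v z le_rfl, ih _ _ _ (by omega), topRow, psum_cons_succ, ← add_assoc,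
        sum_colStep, add_assoc]

end Increments

/-! ### The exact exponential moment identity. -/

section ExponentialMoment

/-- An exponentially tilted Bernoulli product is, up to normalization, a Bernoulli product with
another parameter. -/
theorem wexp_tilt {q q' t K : ℝ} (h : ∀ b, bernWeight q b * Real.exp (t * bval b) =
    K * bernWeight q' b) {n : ℕ} (g : (Fin n → Bool) → ℝ) :
    bernExp q (fun v => Real.exp (t * ∑ j, bval (v j)) * g v) = K ^ n * bernExp q' g := by
  simp only [bernExp, wexp, prodWeight, Finset.mul_sum]
  refine Finset.sum_congr rfl fun v _ => ?_
  rw [Real.exp_sum, ← mul_assoc, ← Finset.prod_mul_distrib]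
  simp only [h, Finset.prod_mul_distrib, Finset.prod_const, Finset.card_univ, Fintype.card_fin]
  ring

/-- The logarithmic moment function of the model. -/
noncomputable def logMoment (l : ℝ) (m n : ℕ) (θ : ℝ) : ℝ :=
  m * Real.log (1 + Real.exp θ) - n * Real.log (1 + Real.exp (l - θ))

theorem isProbWeight_sigmoid (θ : ℝ) : IsProbWeight (bernWeight (Real.sigmoid θ)) :=
  isProbWeight_bern (Real.sigmoid_nonneg θ) (Real.sigmoid_le_one θ)

theorem sigmoid_eq_div (θ : ℝ) : Real.sigmoid θ = Real.exp θ / (1 + Real.exp θ) := by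
  rw [Real.sigmoid_def, Real.exp_neg]
  have := Real.exp_pos θ
  field_simp
  ring

theorem one_sub_sigmoid (θ : ℝ) : 1 - Real.sigmoid θ = 1 / (1 + Real.exp θ) := by
  rw [sigmoid_eq_div]
  have := Real.exp_pos θ
  field_simp
  ring

theorem sigmoid_stationary (l θ : ℝ) : Real.sigmoid θ * Real.sigmoid (l - θ) =
    Real.exp l * ((1 - Real.sigmoid θ) * (1 - Real.sigmoid (l - θ))) := by
  rw [one_sub_sigmoid, one_sub_sigmoid, sigmoid_eq_div, sigmoid_eq_div, Real.exp_sub]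
  have := Real.exp_pos θ
  have := Real.exp_pos l
  field_simp

/-- The exact exponential moment of the passage time with independent boundaries. -/
theorem wexp_exp_lpp {l : ℝ} (hp : IsProbWeight (bernWeight (Real.exp l))) (m n : ℕ)
    (θ₁ θ₂ : ℝ) :
    bernExp (Real.sigmoid θ₁) (fun s : Fin m → Bool => bernExp (Real.sigmoid (l - θ₂))
      fun v : Fin n → Bool => bulkExp (Real.exp l) fun x : Fin m → Fin n → Bool =>
        Real.exp ((θ₂ - θ₁) * lpp (wt x) (psum s) (psum v) m n)) =
    Real.exp (logMoment l m n θ₂ - logMoment l m n θ₁) := by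
  have e1 := Real.exp_pos θ₁
  have e2 := Real.exp_pos θ₂
  have el := Real.exp_pos l
  set t := θ₂ - θ₁ with ht
  set K := (1 + Real.exp (l - θ₁)) / (1 + Real.exp (l - θ₂)) with hK
  -- Tilting by t = θ₂-θ₁ multiplies the odds by exp t, so the log-odds l-θ₂ become l-θ₁, the
  -- partner of θ₁ on the stationary line.
  have htilt : ∀ b, bernWeight (Real.sigmoid (l - θ₂)) b * Real.exp (t * bval b) =
      K * bernWeight (Real.sigmoid (l - θ₁)) b := by
    intro b
    cases b
    · simp only [bernWeight, bval, one_sub_sigmoid, hK]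
      simp
      field_simp
    · simp only [bernWeight, bval, sigmoid_eq_div, hK, ht, Real.exp_sub, if_true, mul_one]
      field_simp
  -- The left-column factor is absorbed as a tilt. The tilted model is stationary, so Burke's
  -- property turns the top-row factor into a plain Bernoulli exponential moment.
  calc _ = bernExp (Real.sigmoid θ₁) (fun s : Fin m → Bool => bernExp (Real.sigmoid (l - θ₂))
      fun v : Fin n → Bool => Real.exp (t * ∑ j, bval (v j)) * bulkExp (Real.exp l) fun x =>
        Real.exp (t * ∑ i, bval (topRow m x s v i))) := by
        refine wexp_congr fun s => wexp_congr fun v => ?_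
        rw [← wexp_const_mul]
        refine wexp_congr fun x => ?_
        rw [lpp_eq_sum_topRow x s v le_rfl, mul_add, Real.exp_add, psum_full]
    _ = K ^ n * bernExp (Real.sigmoid θ₁) (fun s : Fin m → Bool =>
        Real.exp (t * ∑ i, bval (s i))) := by
        rw [← wexp_topRow (n := n) (sigmoid_stationary l θ₁) hp (isProbWeight_sigmoid _)
          (fun s : Fin m → Bool => Real.exp (t * ∑ i, bval (s i))), ← wexp_const_mul]
        exact wexp_congr fun s => wexp_tilt htilt fun v => bulkExp (Real.exp l) fun x =>
          Real.exp (t * ∑ i, bval (topRow m x s v i))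
    _ = _ := by
        rw [bernExp, wexp_bern_exp_sum]
        have h1 : 1 - Real.sigmoid θ₁ + Real.sigmoid θ₁ * Real.exp t =
            (1 + Real.exp θ₂) / (1 + Real.exp θ₁) := by
          rw [one_sub_sigmoid, sigmoid_eq_div, ht, Real.exp_sub]
          field_simp
        have hl : ∀ (a : ℝ) (k : ℕ), Real.exp (k * Real.log (1 + Real.exp a)) =
            (1 + Real.exp a) ^ k := fun a k => by
          rw [mul_comm, Real.exp_mul, Real.exp_log (by positivity), Real.rpow_natCast]
        rw [h1, hK, div_pow, div_pow]
        simp only [logMoment, Real.exp_sub (_ - _), Real.exp_sub (_ * _), hl]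
        have := Real.exp_pos (l - θ₁)
        have := Real.exp_pos (l - θ₂)
        field_simp

end ExponentialMoment

/-! ### Chernoff bounds for boundary models and exit events. -/

section Tails

variable {l : ℝ} {m n : ℕ}

theorem lpp_psum_mono (x : Fin m → Fin n → Bool) {s s' : Fin m → Bool} (h : s ≤ s') :
    lpp (wt x) (psum s) (fun _ => 0) m n ≤ lpp (wt x) (psum s') (fun _ => 0) m n :=
  lpp_mono (psum_le_psum h) (fun _ => le_rfl) m n

/-- Upper tail of the passage time with a horizontal boundary. -/
theorem wexp_le_lpp_horizontal (hp : IsProbWeight (bernWeight (Real.exp l))) {lam θ t : ℝ}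
    (hlam : lam ≤ θ) (ht : 0 ≤ t) (X : ℝ) :
    bernExp (Real.sigmoid lam) (fun s : Fin m → Bool => bulkExp (Real.exp l)
      fun x : Fin m → Fin n → Bool => ind (X ≤ lpp (wt x) (psum s) (fun _ => 0) m n)) ≤
    Real.exp (logMoment l m n (θ + t) - logMoment l m n θ - t * X) := by
  have hmono : Monotone fun s : Fin m → Bool => bulkExp (Real.exp l)
      fun x : Fin m → Fin n → Bool => ind (X ≤ lpp (wt x) (psum s) (fun _ => 0) m n) :=
    fun s s' h => hp.prod.prod.wexp_mono fun x => ind_mono fun hX => hX.trans (lpp_psum_mono x h)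
  refine (wexp_bern_mono_param (Real.sigmoid_nonneg _) (Real.sigmoid_le hlam)
    (Real.sigmoid_le_one _) hmono).trans ?_
  have key := wexp_exp_lpp hp m n θ (θ + t)
  rw [sub_eq_add_neg _ (t * X), Real.exp_add, ← key, ← wexp_mul_const]
  refine (isProbWeight_sigmoid θ).prod.wexp_mono fun s => ?_
  -- An auxiliary vertical boundary is inserted. It can only increase the passage time, and it makes
  -- the exact moment identity available.
  have hv := (isProbWeight_sigmoid (l - (θ + t))).prod (ι := Fin n)
  rw [← wexp_mul_const, ← hv.wexp_const (bulkExp _ _)]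
  refine hv.wexp_mono fun v => ?_
  rw [← wexp_mul_const]
  refine hp.prod.prod.wexp_mono fun x => ?_
  rw [← Real.exp_add]
  refine ind_le_exp fun hX => ?_
  have h := hX.trans (lpp_mono (fun _ => le_rfl) (psum_nonneg v) m n)
  nlinarith

/-- Lower tail of the passage time with two boundaries. -/
theorem wexp_lpp_lt (hp : IsProbWeight (bernWeight (Real.exp l))) {θ₁ θ₂ : ℝ} (h : θ₂ ≤ θ₁)
    (X : ℝ) :
    bernExp (Real.sigmoid θ₁) (fun s : Fin m → Bool => bernExp (Real.sigmoid (l - θ₂))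
      fun v : Fin n → Bool => bulkExp (Real.exp l) fun x : Fin m → Fin n → Bool =>
        ind (lpp (wt x) (psum s) (psum v) m n < X)) ≤
    Real.exp (logMoment l m n θ₂ - logMoment l m n θ₁ + (θ₁ - θ₂) * X) := by
  rw [Real.exp_add, ← wexp_exp_lpp hp, ← wexp_mul_const]
  refine (isProbWeight_sigmoid _).prod.wexp_mono fun s => ?_
  rw [← wexp_mul_const]
  refine (isProbWeight_sigmoid _).prod.wexp_mono fun v => ?_
  rw [← wexp_mul_const]
  refine hp.prod.prod.wexp_mono fun x => ?_
  rw [← Real.exp_add]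
  refine ind_le_exp fun hX => ?_
  nlinarith

/-- The event that some path leaving the horizontal boundary beyond `z` has weight at least `X`. -/
def FarExit (z : ℕ) (X : ℝ) (s : Fin m → Bool) (w : ℕ → ℕ → ℝ) (n : ℕ) : Prop :=
  ∃ y ≤ m, z ≤ y ∧ X ≤ psum s y + bulkLpp (shiftCol y w) (m - y) n

/-- A path that exits beyond z surely collects the first z boundary bits and never sees the first z
columns. Those bits contribute their moment generating function at the true parameter, and the
remaining m-z columns are bounded at the larger parameter θ. -/
theorem wexp_farExit (hp : IsProbWeight (bernWeight (Real.exp l))) {lam θ t : ℝ}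
    (hlam : lam ≤ θ) (ht : 0 ≤ t) (X : ℝ) {z : ℕ} (hz : z ≤ m) :
    bernExp (Real.sigmoid lam) (fun s : Fin m → Bool => bulkExp (Real.exp l)
      fun x : Fin m → Fin n → Bool => ind (FarExit z X s (wt x) n)) ≤
    (1 - Real.sigmoid lam + Real.sigmoid lam * Real.exp t) ^ z *
      Real.exp (logMoment l (m - z) n (θ + t) - logMoment l (m - z) n θ - t * X) := by
  induction z generalizing m X with
  | zero =>
    simp only [pow_zero, one_mul, Nat.sub_zero]
    refine le_trans ?_ (wexp_le_lpp_horizontal hp hlam ht X)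
    refine (isProbWeight_sigmoid _).prod.wexp_mono fun s => hp.prod.prod.wexp_mono fun x =>
      ind_mono ?_
    rintro ⟨y, hy, -, h⟩
    refine h.trans ?_
    have := add_bulkLpp_le_lpp (w := wt x) (V := fun _ => 0) (psum_mono s) (fun _ => le_rfl)
      (psum_zero s) y (m - y) n
    rwa [Nat.add_sub_cancel' hy] at this
  | succ z ih =>
    obtain ⟨m, rfl⟩ : ∃ k, m = k + 1 := ⟨m - 1, by omega⟩
    have hstep : ∀ (b : Bool) (s : Fin m → Bool) (c : Fin n → Bool) (x : Fin m → Fin n → Bool),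
        ind (FarExit (z + 1) X (Fin.cons b s : Fin (m + 1) → Bool)
          (wt (Fin.cons c x : Fin (m + 1) → Fin n → Bool)) n) ≤
        ind (FarExit z (X - bval b) s (wt x) n) := by
      intro b s c x
      refine ind_mono ?_
      rintro ⟨y, hy, hzy, h⟩
      obtain ⟨y, rfl⟩ : ∃ k, y = k + 1 := ⟨y - 1, by omega⟩
      refine ⟨y, by omega, by omega, ?_⟩
      rw [psum_cons_succ] at h
      have hs : shiftCol (y + 1) (wt (Fin.cons c x : Fin (m + 1) → Fin n → Bool)) =
          shiftCol y (wt x) := by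
        funext i j
        simp only [shiftCol]
        rw [add_right_comm, wt_succ, Fin.tail_cons]
      rw [hs, Nat.add_sub_add_right] at h
      linarith
    simp only [bernExp, bulkExp]
    rw [wexp_prod_succ]
    simp only [wexp_prod_succ (w := prodWeight (bernWeight (Real.exp l)))]
    refine ((isProbWeight_sigmoid lam).wexp_mono (g := fun b =>
      (1 - Real.sigmoid lam + Real.sigmoid lam * Real.exp t) ^ z *
      Real.exp (logMoment l (m - z) n (θ + t) - logMoment l (m - z) n θ - t * (X - bval b)))
      fun b => ?_).trans ?_
    · refine le_trans ?_ (ih (X - bval b) (by omega))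
      refine (isProbWeight_sigmoid _).prod.wexp_mono fun s => ?_
      exact hp.prod.wexp_le fun c => hp.prod.prod.wexp_mono fun x => hstep b s c x
    · rw [wexp_const_mul, wexp_bern, Nat.add_sub_add_right, pow_succ, mul_assoc]
      refine le_of_eq ?_
      congr 1
      have h1 : bval true = 1 := by simp [bval]
      have h2 : bval false = 0 := by simp [bval]
      rw [h1, h2, sub_zero, mul_sub, mul_one,
        show ∀ a : ℝ, a - (t * X - t) = a - t * X + t by intro a; ring, Real.exp_add _ t]
      ring

/-- Maximal inequality for the difference of two Bernoulli random walks. -/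
theorem wexp_walk_max {u v t ρ : ℝ} (hu : IsProbWeight (bernWeight u))
    (hv : IsProbWeight (bernWeight v)) (ht : 0 ≤ t) (hρ1 : 1 ≤ ρ)
    (hρ : (1 - u + u * Real.exp t) * (1 - v + v * Real.exp (-t)) ≤ ρ) (z : ℕ) (B : ℝ) :
    bernExp u (fun s : Fin m → Bool => bernExp v fun c : Fin m → Bool =>
      ind (∃ y ≤ z, B ≤ psum s y - psum c y)) ≤ ρ ^ z * Real.exp (-(t * B)) := by
  induction m generalizing z B with
  | zero =>
    simp only [bernExp, wexp_prod_zero]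
    refine (ind_le_exp (r := -(t * B)) ?_).trans ?_
    · rintro ⟨y, -, h⟩
      simp only [psum, Finset.univ_eq_empty, Finset.sum_empty, sub_zero] at h
      nlinarith
    · exact le_mul_of_one_le_left (Real.exp_pos _).le (one_le_pow₀ hρ1)
  | succ m ih =>
    -- For B ≤ 0 the claimed bound is at least 1. For B > 0 the time y = 0 cannot realize the event,
    -- so the first step of the walk can be peeled off.
    by_cases hB : B ≤ 0
    · refine hu.prod.wexp_le fun s => hv.prod.wexp_le fun c => (ind_le_one _).trans ?_
      exact one_le_mul_of_one_le_of_one_le (one_le_pow₀ hρ1)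
        (Real.one_le_exp (by nlinarith))
    cases z with
    | zero =>
      refine hu.prod.wexp_le fun s => hv.prod.wexp_le fun c => ?_
      rw [ind_of_not]
      · positivity
      · rintro ⟨y, hy, h⟩
        rw [Nat.le_zero.1 hy, psum_zero, psum_zero] at h
        exact hB (by linarith)
    | succ z =>
      have hstep : ∀ (b d : Bool) (s c : Fin m → Bool),
          ind (∃ y ≤ z + 1, B ≤ psum (Fin.cons b s : Fin (m + 1) → Bool) y -
            psum (Fin.cons d c : Fin (m + 1) → Bool) y) ≤
          ind (∃ y ≤ z, B - (bval b - bval d) ≤ psum s y - psum c y) := by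
        intro b d s c
        refine ind_mono ?_
        rintro ⟨y, hy, h⟩
        cases y with
        | zero => rw [psum_zero, psum_zero] at h; exact absurd (by linarith) hB
        | succ y =>
          rw [psum_cons_succ, psum_cons_succ] at h
          exact ⟨y, by omega, by linarith⟩
      calc _ = wexp (bernWeight u) (fun b => wexp (bernWeight v) fun d =>
            bernExp u fun s : Fin m → Bool => bernExp v fun c : Fin m → Bool =>
              ind (∃ y ≤ z + 1, B ≤ psum (Fin.cons b s : Fin (m + 1) → Bool) y -
                psum (Fin.cons d c : Fin (m + 1) → Bool) y)) := by
            simp only [bernExp]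
            rw [wexp_prod_succ]
            refine wexp_congr fun b => ?_
            rw [wexp_comm]
            rw [wexp_prod_succ]
            refine wexp_congr fun d => ?_
            rw [wexp_comm]
        _ ≤ wexp (bernWeight u) (fun b => wexp (bernWeight v) fun d =>
            ρ ^ z * Real.exp (-(t * (B - (bval b - bval d))))) :=
            hu.wexp_mono fun b => hv.wexp_mono fun d => le_trans
              (hu.prod.wexp_mono fun s => hv.prod.wexp_mono fun c => hstep b d s c) (ih z _)
        _ = ((1 - u + u * Real.exp t) * (1 - v + v * Real.exp (-t))) *
              (ρ ^ z * Real.exp (-(t * B))) := by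
            have h : ∀ b d, Real.exp (-(t * (B - (bval b - bval d)))) = Real.exp (-(t * B)) *
                (Real.exp (t * bval b) * Real.exp (-t * bval d)) := fun b d => by
              rw [← Real.exp_add, ← Real.exp_add]; congr 1; ring
            simp only [h, wexp_const_mul, wexp_bern]
            simp only [bval, if_true, Bool.false_eq_true, if_false, mul_one, mul_zero,
              Real.exp_zero]
            ring
        _ ≤ ρ * (ρ ^ z * Real.exp (-(t * B))) :=
            mul_le_mul_of_nonneg_right hρ (by positivity)
        _ = _ := by rw [pow_succ]; ring

/-- The event that the passage time with the horizontal boundary exceeds the one with the vertical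
boundary is unlikely for small parameters. -/
theorem wexp_horizontal_exit (hp : IsProbWeight (bernWeight (Real.exp l))) {lam θ₁ θ t : ℝ}
    (h₁ : lam ≤ θ₁) (hθ : θ₁ ≤ θ) (ht : 0 ≤ t) (X : ℝ) :
    bernExp (Real.sigmoid lam) (fun s : Fin m → Bool => bernExp (Real.sigmoid (l - lam))
      fun v : Fin n → Bool => bulkExp (Real.exp l) fun x : Fin m → Fin n → Bool =>
        ind (lpp (wt x) (fun _ => 0) (psum v) m n < lpp (wt x) (psum s) (fun _ => 0) m n)) ≤
    2 * Real.exp (logMoment l m n (θ + t) - logMoment l m n θ - t * X) +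
      Real.exp (logMoment l m n lam - logMoment l m n θ₁ + (θ₁ - lam) * X) := by
  have hv := (isProbWeight_sigmoid (l - lam)).prod (ι := Fin n)
  have hu := fun a => (isProbWeight_sigmoid a).prod (ι := Fin m)
  have hx := hp.prod.prod (ι := Fin m) (α := Fin n → Bool)
  -- An auxiliary horizontal boundary of parameter θ₁ is added. If the vertical model is below X,
  -- then either the two-boundary model is below X or the auxiliary horizontal model reaches X, and
  -- both have exponential bounds.
  have hvert : bernExp (Real.sigmoid (l - lam)) (fun v : Fin n → Bool => bulkExp (Real.exp l)
      fun x : Fin m → Fin n → Bool => ind (lpp (wt x) (fun _ => 0) (psum v) m n < X)) ≤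
      Real.exp (logMoment l m n lam - logMoment l m n θ₁ + (θ₁ - lam) * X) +
      Real.exp (logMoment l m n (θ + t) - logMoment l m n θ - t * X) := by
    rw [← (hu θ₁).wexp_const (bernExp _ _)]
    refine le_trans ?_ (add_le_add (wexp_lpp_lt (m := m) (n := n) hp h₁ X)
      (wexp_le_lpp_horizontal (m := m) (n := n) hp hθ ht X))
    rw [← wexp_add]
    refine (hu θ₁).wexp_mono fun s => ?_
    rw [← hv.wexp_const (bulkExp _ _), ← wexp_add]
    refine hv.wexp_mono fun v => ?_
    rw [← wexp_add]
    refine hx.wexp_mono fun x => ?_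
    refine ind_le_of (add_nonneg (ind_nonneg _) (ind_nonneg _)) fun h => ?_
    by_cases hX : X ≤ lpp (wt x) (psum s) (fun _ => 0) m n
    · rw [ind_of hX]; linarith [ind_nonneg (lpp (wt x) (psum s) (psum v) m n < X)]
    · have : lpp (wt x) (psum s) (psum v) m n < X := by
        rw [lpp_eq_max (psum_nonneg s) (psum_nonneg v) (psum_zero s) (psum_zero v)]
        exact max_lt (not_le.1 hX) h
      rw [ind_of this]
      linarith [ind_nonneg (X ≤ lpp (wt x) (psum s) (fun _ => 0) m n)]
  have hhor := wexp_le_lpp_horizontal (m := m) (n := n) hp (h₁.trans hθ) ht X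
  have hsum := add_le_add hhor hvert
  refine le_trans ?_ (hsum.trans (by linarith))
  rw [← (hu lam).wexp_const (bernExp (Real.sigmoid (l - lam)) _), ← wexp_add]
  refine (hu lam).wexp_mono fun s => ?_
  rw [← hv.wexp_const (bulkExp _ fun x => ind (X ≤ _)), ← wexp_add]
  refine hv.wexp_mono fun v => ?_
  rw [← wexp_add]
  refine hx.wexp_mono fun x => ?_
  refine ind_le_of (add_nonneg (ind_nonneg _) (ind_nonneg _)) fun h => ?_
  by_cases hX : X ≤ lpp (wt x) (psum s) (fun _ => 0) m n
  · rw [ind_of hX]; linarith [ind_nonneg (lpp (wt x) (fun _ => 0) (psum v) m n < X)]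
  · rw [ind_of (h.trans (not_le.1 hX))]
    linarith [ind_nonneg (X ≤ lpp (wt x) (psum s) (fun _ => 0) m n)]

theorem psum_rev (s : Fin m → Bool) {z : ℕ} (hz : z ≤ m) :
    psum (fun i => s i.rev) z = psum s m - psum s (m - z) := by
  induction z with
  | zero => simp
  | succ z ih =>
    rw [psum_step _ z (by omega), ih (by omega)]
    have h := psum_step s (m - (z + 1)) (by omega)
    rw [show m - (z + 1) + 1 = m - z by omega] at h
    have : (⟨z, by omega⟩ : Fin m).rev = ⟨m - (z + 1), by omega⟩ := by
      ext; simp [Fin.val_rev]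
    rw [this]
    linarith

/-- The event that a path towards the end boundary is good, while the bulk passage time is not. -/
def NearExit (z : ℕ) (X B : ℝ) (s : Fin m → Bool) (w : ℕ → ℕ → ℝ) (n : ℕ) : Prop :=
  ∃ y ≤ m, y ≤ z ∧ X ≤ psum s y + bulkLpp w (m - y) n ∧ bulkLpp w m n < X - B

/-- On the near exit event the walk `T` gains more than B over the bulk across the last y columns.
Bulk increments dominate those of the vertical-boundary model. If the vertical boundary wins at (m,
n), these in turn dominate the stationary increments, which by Burke's property form a Bernoulli
walk of parameter σ(lam) independent of `T`. -/
theorem wexp_nearExit (hp : IsProbWeight (bernWeight (Real.exp l))) {lam u t ρ : ℝ}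
    (hu : IsProbWeight (bernWeight u)) (ht : 0 ≤ t) (hρ1 : 1 ≤ ρ)
    (hρ : (1 - u + u * Real.exp t) * (1 - Real.sigmoid lam + Real.sigmoid lam * Real.exp (-t)) ≤ ρ)
    (z : ℕ) (X B : ℝ) :
    bernExp u (fun T : Fin m → Bool => bulkExp (Real.exp l)
      fun x : Fin m → Fin n → Bool => ind (NearExit z X B T (wt x) n)) ≤
    bernExp (Real.sigmoid lam) (fun s : Fin m → Bool => bernExp (Real.sigmoid (l - lam))
      fun v : Fin n → Bool => bulkExp (Real.exp l) fun x : Fin m → Fin n → Bool =>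
        ind (lpp (wt x) (fun _ => 0) (psum v) m n < lpp (wt x) (psum s) (fun _ => 0) m n)) +
    ρ ^ z * Real.exp (-(t * B)) := by
  have hv := (isProbWeight_sigmoid (l - lam)).prod (ι := Fin n)
  have hs := (isProbWeight_sigmoid lam).prod (ι := Fin m)
  have hx := hp.prod.prod (ι := Fin m) (α := Fin n → Bool)
  have hT := hu.prod (ι := Fin m)
  have hw := wexp_walk_max (m := m) hu (isProbWeight_sigmoid lam) ht hρ1 hρ z B
  refine le_trans ?_ (add_le_add_right hw _)
  rw [← hT.wexp_const (bernExp (Real.sigmoid lam) _), ← wexp_add]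
  refine hT.wexp_mono fun T => ?_
  -- The comparison walk is first reversed in time, since the relevant increments are the last y of
  -- the top row, and then realized as a stationary top row.
  have hwalk := (wexp_reindex (w := bernWeight (Real.sigmoid lam)) Fin.revPerm
    (fun c : Fin m → Bool => ind (∃ y ≤ z, B ≤ psum T y - psum c y))).symm.trans
    (wexp_topRow (n := n) (sigmoid_stationary l lam) hp (isProbWeight_sigmoid _)
      (fun s : Fin m → Bool =>
        ind (∃ y ≤ z, B ≤ psum T y - psum (fun i => s (Fin.revPerm i)) y))).symm
  rw [bernExp, bernExp, hwalk, ← wexp_add, ← hs.wexp_const (bulkExp _ _)]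
  refine hs.wexp_mono fun s => ?_
  rw [← wexp_add, ← hv.wexp_const (bulkExp _ fun x => ind (NearExit _ _ _ _ _ _))]
  refine hv.wexp_mono fun v => ?_
  rw [← wexp_add]
  refine hx.wexp_mono fun x => ?_
  refine ind_le_of (add_nonneg (ind_nonneg _) (ind_nonneg _)) ?_
  rintro ⟨y, hym, hyz, hX, hB⟩
  by_cases hbad : lpp (wt x) (fun _ => 0) (psum v) m n < lpp (wt x) (psum s) (fun _ => 0) m n
  · rw [ind_of hbad]
    exact le_add_of_nonneg_right (ind_nonneg _)
  · have hgood : ∃ y ≤ z, B ≤ psum T y - psum (fun i => topRow m x s v (Fin.revPerm i)) y := by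
      refine ⟨y, hyz, ?_⟩
      have h1 := psum_rev (topRow m x s v) hym
      have h2 := lpp_eq_sum_topRow x s v (le_refl m)
      have h3 := lpp_eq_sum_topRow x s v (Nat.sub_le m y)
      have h4 := lpp_increment_le (w := wt x) (psum_mono v) (psum_zero v) (m - y) y n
      rw [Nat.sub_add_cancel hym] at h4
      rw [lpp_eq_max (psum_nonneg s) (psum_nonneg v) (psum_zero s) (psum_zero v),
        max_eq_right (not_lt.1 hbad)] at h2
      have h5 : lpp (wt x) (fun _ => 0) (psum v) (m - y) n ≤
          lpp (wt x) (psum s) (psum v) (m - y) n :=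
        lpp_mono (psum_nonneg s) (fun _ => le_rfl) _ _
      change B ≤ psum T y - psum (fun i => topRow m x s v i.rev) y
      linarith
    rw [ind_of hgood]
    exact le_add_of_nonneg_left (ind_nonneg _)

end Tails

/-! ### Reduction of the bulk lower tail to exit events. -/

section LowerTail

variable {l : ℝ} {m n : ℕ}

/-- The rectangle of bits read backwards. -/
def reverseBits (x : Fin m → Fin n → Bool) : Fin m → Fin n → Bool := fun i j => x i.rev j.rev

/-- The transposed rectangle of bits. -/
def transposeBits (x : Fin m → Fin n → Bool) : Fin n → Fin m → Bool := fun j i => x i j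

theorem bulkExp_reverse (q : ℝ) (f : (Fin m → Fin n → Bool) → ℝ) :
    bulkExp q (fun x => f (reverseBits x)) = bulkExp q f := by
  have h1 : bulkExp q f = bulkExp q fun x => f fun i => x i.rev :=
    (wexp_reindex Fin.revPerm f).symm
  rw [h1]
  have h2 := wexp_transpose (w := bernWeight q)
    (fun y : Fin n → Fin m → Bool => f fun i j => y j i.rev)
  have h3 := wexp_transpose (w := bernWeight q)
    (fun y : Fin n → Fin m → Bool => f fun i j => y j.rev i.rev)
  have h4 := wexp_reindex (w := prodWeight (bernWeight q)) Fin.revPerm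
    (fun y : Fin n → Fin m → Bool => f fun i j => y j i.rev)
  exact h3.trans (h4.trans h2.symm)

theorem bulkExp_transpose (q : ℝ) (f : (Fin n → Fin m → Bool) → ℝ) :
    bulkExp q (fun x : Fin m → Fin n → Bool => f (transposeBits x)) = bulkExp q f :=
  wexp_transpose f

theorem wt_transpose (x : Fin m → Fin n → Bool) :
    wt (transposeBits x) = fun j i => wt x i j := by
  funext j i
  simp only [wt, transposeBits, and_comm]

theorem bulkLpp_shiftRow_eq (w : ℕ → ℕ → ℝ) (z i j : ℕ) :
    bulkLpp (shiftRow z w) i j = bulkLpp (shiftCol z fun j i => w i j) j i :=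
  (bulkLpp_transpose (w := shiftRow z w) i j).symm

/-- A half-turn carries the right-hand part of the reversed rectangle to the left-hand part of the
original. Exits then compare bulk times with a common starting corner, as the increment comparison
needs. -/
theorem bulkLpp_shiftCol_reverse (x : Fin m → Fin n → Bool) {z : ℕ} (hz : z ≤ m) :
    bulkLpp (shiftCol z (wt (reverseBits x))) (m - z) n = bulkLpp (wt x) (m - z) n := by
  rw [← bulkLpp_reverse (wt_nonneg x) (m - z) n]
  refine bulkLpp_congr fun i hi j hj => ?_
  have h1 : z + i < m := by omega
  have h2 : m - z - 1 - i < m := by omega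
  have h3 : n - 1 - j < n := by omega
  simp only [shiftCol, wt, reverseBits, h1, hj, h2, h3, and_self, dite_true]
  congr 2
  · ext; simp only [Fin.val_rev]; omega
  · ext; simp only [Fin.val_rev]; omega

/-- The lower tail of the bulk passage time, in terms of exit events. -/
theorem wexp_bulkLpp_lt_le (hp : IsProbWeight (bernWeight (Real.exp l))) {u v : ℝ}
    (hu : IsProbWeight (bernWeight u)) (hv : IsProbWeight (bernWeight v)) (X B : ℝ) (z z' : ℕ) :
    bulkExp (Real.exp l) (fun x : Fin m → Fin n → Bool => ind (bulkLpp (wt x) m n < X - B)) ≤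
    bernExp u (fun s : Fin m → Bool => bernExp v fun c : Fin n → Bool => bulkExp (Real.exp l)
      fun x : Fin m → Fin n → Bool => ind (lpp (wt x) (psum s) (psum c) m n < X)) +
    (bernExp u (fun s : Fin m → Bool => bulkExp (Real.exp l)
      fun x : Fin m → Fin n → Bool => ind (FarExit z X s (wt x) n)) +
    bernExp u (fun s : Fin m → Bool => bulkExp (Real.exp l)
      fun x : Fin m → Fin n → Bool => ind (NearExit z X B s (wt x) n))) +
    (bernExp v (fun c : Fin n → Bool => bulkExp (Real.exp l)
      fun x : Fin n → Fin m → Bool => ind (FarExit z' X c (wt x) m)) +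
    bernExp v (fun c : Fin n → Bool => bulkExp (Real.exp l)
      fun x : Fin n → Fin m → Bool => ind (NearExit z' X B c (wt x) m))) := by
  have hU := hu.prod (ι := Fin m)
  have hV := hv.prod (ι := Fin n)
  have hX := hp.prod.prod (ι := Fin m) (α := Fin n → Bool)
  rw [← hU.wexp_const (bulkExp _ fun x => ind (bulkLpp (wt x) m n < X - B)),
    ← hU.wexp_const (bernExp v (fun c : Fin n → Bool => bulkExp (Real.exp l)
      fun x : Fin n → Fin m → Bool => ind (FarExit z' X c (wt x) m)) + _),
    ← wexp_add, ← wexp_add, ← wexp_add]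
  refine hU.wexp_mono fun s => ?_
  generalize hFN : bulkExp (Real.exp l) (fun x : Fin m → Fin n → Bool =>
    ind (FarExit z X s (wt x) n)) + _ = FN
  rw [← hV.wexp_const (bulkExp _ fun x => ind (bulkLpp (wt x) m n < X - B)),
    ← hV.wexp_const FN, ← wexp_add, ← wexp_add, ← wexp_add]
  refine hV.wexp_mono fun c => ?_
  rw [← hFN]
  -- Bulk weights are invariant in law under reversal and transposition. The boundary model and the
  -- far exits are read in the reversed environment, the near exits in the original one, and
  -- vertical exits become horizontal ones after transposition.
  rw [← bulkExp_reverse _ fun x => ind (lpp (wt x) (psum s) (psum c) m n < X),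
    ← bulkExp_reverse _ fun x => ind (FarExit z X s (wt x) n),
    ← bulkExp_transpose _ fun x => ind (FarExit z' X c (wt x) m),
    ← bulkExp_transpose _ fun x => ind (NearExit z' X B c (wt x) m),
    ← bulkExp_reverse _ fun x => ind (FarExit z' X c (wt (transposeBits x)) m),
    ← wexp_add, ← wexp_add, ← wexp_add, ← wexp_add]
  refine hX.wexp_mono fun x => ?_
  have n1 := ind_nonneg (lpp (wt (reverseBits x)) (psum s) (psum c) m n < X)
  have n2 := ind_nonneg (FarExit z X s (wt (reverseBits x)) n)
  have n3 := ind_nonneg (NearExit z X B s (wt x) n)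
  have n4 := ind_nonneg (FarExit z' X c (wt (transposeBits (reverseBits x))) m)
  have n5 := ind_nonneg (NearExit z' X B c (wt (transposeBits x)) m)
  refine ind_le_of (by positivity) fun hlt => ?_
  by_cases h1 : lpp (wt (reverseBits x)) (psum s) (psum c) m n < X
  · rw [ind_of h1]; linarith
  rcases lpp_le_exit (w := wt (reverseBits x)) (psum_zero s) (psum_zero c) m n with
    ⟨y, hy, h⟩ | ⟨y, hy, h⟩
  · by_cases hyz : z ≤ y
    · have : FarExit z X s (wt (reverseBits x)) n := ⟨y, hy, hyz, (not_lt.1 h1).trans h⟩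
      rw [ind_of this]; linarith
    · have : NearExit z X B s (wt x) n :=
        ⟨y, hy, by omega, bulkLpp_shiftCol_reverse x hy ▸ (not_lt.1 h1).trans h, hlt⟩
      rw [ind_of this]; linarith
  · have h' : X ≤ psum c y + bulkLpp (shiftCol y (wt (transposeBits (reverseBits x)))) (n - y) m := by
      rw [wt_transpose, ← bulkLpp_shiftRow_eq]
      exact (not_lt.1 h1).trans h
    by_cases hyz : z' ≤ y
    · have : FarExit z' X c (wt (transposeBits (reverseBits x))) m := ⟨y, hy, hyz, h'⟩
      rw [ind_of this]; linarith
    · have : NearExit z' X B c (wt (transposeBits x)) m := by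
        refine ⟨y, hy, by omega, ?_, ?_⟩
        · have := bulkLpp_shiftCol_reverse (transposeBits x) hy
          rw [← this]
          exact h'
        · rw [wt_transpose]
          exact (bulkLpp_transpose (w := wt x) m n).trans_lt hlt
      rw [ind_of this]; linarith

end LowerTail

/-! ### Derivatives of the logarithmic moment. -/

section Calculus

theorem le_slope_of_hasDerivAt {f f' : ℝ → ℝ} {a b K : ℝ} (hab : a ≤ b)
    (hf : ∀ x, HasDerivAt f (f' x) x) (h : ∀ x, a ≤ x → x ≤ b → K ≤ f' x) :
    K * (b - a) ≤ f b - f a := by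
  refine (convex_Icc a b).mul_sub_le_image_sub_of_le_deriv
    (fun x _ => (hf x).continuousAt.continuousWithinAt)
    (fun x _ => (hf x).differentiableAt.differentiableWithinAt) (fun x hx => ?_)
    a (Set.left_mem_Icc.2 hab) b (Set.right_mem_Icc.2 hab) hab
  rw [(hf x).deriv]
  have := interior_subset hx
  exact h x this.1 this.2

theorem slope_le_of_hasDerivAt {f f' : ℝ → ℝ} {a b K : ℝ} (hab : a ≤ b)
    (hf : ∀ x, HasDerivAt f (f' x) x) (h : ∀ x, a ≤ x → x ≤ b → f' x ≤ K) :
    f b - f a ≤ K * (b - a) := by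
  have := le_slope_of_hasDerivAt (f := fun x => -f x) (K := -K) hab (fun x => (hf x).neg)
    fun x h1 h2 => neg_le_neg (h x h1 h2)
  linarith

theorem hasDerivAt_log_one_add_exp (θ : ℝ) :
    HasDerivAt (fun θ => Real.log (1 + Real.exp θ)) (Real.sigmoid θ) θ := by
  have h := ((Real.hasDerivAt_exp θ).const_add 1).log (by positivity)
  rwa [← sigmoid_eq_div] at h

/-- The derivative is the mean passage time of the stationary model with parameter θ. -/
theorem hasDerivAt_logMoment (l : ℝ) (m n : ℕ) (θ : ℝ) :
    HasDerivAt (logMoment l m n) (m * Real.sigmoid θ + n * Real.sigmoid (l - θ)) θ := by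
  have h1 := (hasDerivAt_log_one_add_exp θ).const_mul (m : ℝ)
  have h2 := ((hasDerivAt_log_one_add_exp (l - θ)).comp θ
    ((hasDerivAt_id θ).const_sub l)).const_mul (n : ℝ)
  have h3 := h1.sub h2
  refine h3.congr_deriv ?_
  ring

theorem sigmoid_sub_le {a b : ℝ} (h : a ≤ b) : Real.sigmoid b - Real.sigmoid a ≤ b - a := by
  have := slope_le_of_hasDerivAt (K := 1) h Real.hasDerivAt_sigmoid fun x _ _ => by
    nlinarith [Real.sigmoid_nonneg x, Real.sigmoid_le_one x]
  linarith

/-- In log-odds the Bernoulli log-moment is an increment of log(1 + exp), so boundary bits can be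
compared directly with columns of `logMoment`. -/
theorem one_sub_add_mul_exp (θ t : ℝ) : 1 - Real.sigmoid θ + Real.sigmoid θ * Real.exp t =
    Real.exp (Real.log (1 + Real.exp (θ + t)) - Real.log (1 + Real.exp θ)) := by
  rw [Real.exp_sub, Real.exp_log (by positivity), Real.exp_log (by positivity), one_sub_sigmoid,
    sigmoid_eq_div, Real.exp_add]
  have := Real.exp_pos θ
  field_simp

theorem log_one_add_exp_sub_le {a b : ℝ} (h : a ≤ b) :
    Real.log (1 + Real.exp b) - Real.log (1 + Real.exp a) ≤ Real.sigmoid b * (b - a) :=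
  slope_le_of_hasDerivAt h hasDerivAt_log_one_add_exp fun _ _ hx => Real.sigmoid_le hx

theorem le_log_one_add_exp_sub {a b : ℝ} (h : a ≤ b) :
    Real.sigmoid a * (b - a) ≤ Real.log (1 + Real.exp b) - Real.log (1 + Real.exp a) :=
  le_slope_of_hasDerivAt h hasDerivAt_log_one_add_exp fun _ hx _ => Real.sigmoid_le hx

end Calculus

/-! ### Tail estimates at scale h around the minimizer. -/

/-- Quadratic bounds around the minimizer `θ₀` of the stationary slope in direction `(x, y)`. -/
structure SlopeBounds (l x y θ₀ μ₀ c C : ℝ) : Prop where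
  c_pos : 0 < c
  C_pos : 0 < C
  lower : ∀ d, |d| ≤ 1 → μ₀ + c * d ^ 2 ≤
    x * Real.sigmoid (θ₀ + d) + y * Real.sigmoid (l - (θ₀ + d))
  upper : ∀ d, |d| ≤ 1 → x * Real.sigmoid (θ₀ + d) + y * Real.sigmoid (l - (θ₀ + d)) ≤
    μ₀ + C * d ^ 2
  increase : ∀ a b, |a| ≤ 1 → |b| ≤ 1 → a ≤ b →
    c * (b - a) ≤ Real.sigmoid (θ₀ + b) - Real.sigmoid (θ₀ + a)

/-- The size of a rectangle is within two of `(N x, N y)`. -/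
structure NearSize (N x y : ℝ) (m n : ℕ) : Prop where
  le_fst : N * x - 2 ≤ m
  fst_le : m ≤ N * x
  le_snd : N * y - 2 ≤ n
  snd_le : n ≤ N * y

theorem NearSize.swap {N x y : ℝ} {m n : ℕ} (h : NearSize N x y m n) : NearSize N y x n m :=
  ⟨h.le_snd, h.snd_le, h.le_fst, h.fst_le⟩

section Estimates

variable {l x y θ₀ μ₀ c C N h : ℝ} {m n : ℕ}

theorem SlopeBounds.logMoment_sub_le (hb : SlopeBounds l x y θ₀ μ₀ c C) (hs : NearSize N x y m n)
    (hN : 0 ≤ N) {a b r : ℝ} (hab : a ≤ b) (ha : -r ≤ a) (hbr : b ≤ r) (hr : r ≤ 1) :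
    logMoment l m n (θ₀ + b) - logMoment l m n (θ₀ + a) ≤ N * (μ₀ + C * r ^ 2) * (b - a) := by
  have := slope_le_of_hasDerivAt (K := N * (μ₀ + C * r ^ 2))
    (show θ₀ + a ≤ θ₀ + b by linarith) (hasDerivAt_logMoment l m n) fun θ h1 h2 => by
      have hd : |θ - θ₀| ≤ 1 := abs_le.2 ⟨by linarith, by linarith⟩
      have hup := hb.upper (θ - θ₀) hd
      rw [add_sub_cancel] at hup
      have hd2 : (θ - θ₀) ^ 2 ≤ r ^ 2 := sq_le_sq' (by linarith) (by linarith)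
      have e1 := mul_le_mul_of_nonneg_right hs.fst_le (Real.sigmoid_nonneg θ)
      have e2 := mul_le_mul_of_nonneg_right hs.snd_le (Real.sigmoid_nonneg (l - θ))
      have e3 := mul_le_mul_of_nonneg_left hup hN
      have e4 := mul_le_mul_of_nonneg_left (mul_le_mul_of_nonneg_left hd2 hb.C_pos.le) hN
      linarith
  simpa using this

/-- The loss of 4 is the rounding error: two sites in each direction, each weighted by a sigmoid at
most 1. -/
theorem SlopeBounds.le_logMoment_sub (hb : SlopeBounds l x y θ₀ μ₀ c C) (hs : NearSize N x y m n)
    (hN : 0 ≤ N) {a b r : ℝ} (hab : a ≤ b) (ha : -1 ≤ a) (hb1 : b ≤ 1)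
    (hr : ∀ d, a ≤ d → d ≤ b → r ≤ d ^ 2) :
    (N * (μ₀ + c * r) - 4) * (b - a) ≤ logMoment l m n (θ₀ + b) - logMoment l m n (θ₀ + a) := by
  have := le_slope_of_hasDerivAt (K := N * (μ₀ + c * r) - 4)
    (show θ₀ + a ≤ θ₀ + b by linarith) (hasDerivAt_logMoment l m n) fun θ h1 h2 => by
      have hd : |θ - θ₀| ≤ 1 := abs_le.2 ⟨by linarith, by linarith⟩
      have hlo := hb.lower (θ - θ₀) hd
      rw [add_sub_cancel] at hlo
      have hd2 : r ≤ (θ - θ₀) ^ 2 := hr _ (by linarith) (by linarith)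
      have e1 := mul_le_mul_of_nonneg_right hs.le_fst (Real.sigmoid_nonneg θ)
      have e2 := mul_le_mul_of_nonneg_right hs.le_snd (Real.sigmoid_nonneg (l - θ))
      have e3 := mul_le_mul_of_nonneg_left hlo hN
      have e4 := mul_le_mul_of_nonneg_left (mul_le_mul_of_nonneg_left hd2 hb.c_pos.le) hN
      have e5 := Real.sigmoid_le_one θ
      have e6 := Real.sigmoid_le_one (l - θ)
      linarith
  simpa using this

theorem SlopeBounds.upper_tail (hb : SlopeBounds l x y θ₀ μ₀ c C) (hs : NearSize N x y m n)
    (hp : IsProbWeight (bernWeight (Real.exp l))) (hN : 0 ≤ N) (h0 : 0 ≤ h) (h1 : h ≤ 1) :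
    bulkExp (Real.exp l) (fun x : Fin m → Fin n → Bool =>
      ind (N * μ₀ + (C + 1) * (N * h ^ 2) ≤ bulkLpp (wt x) m n)) ≤ Real.exp (-(N * h ^ 3)) := by
  have key := wexp_le_lpp_horizontal (m := m) (n := n) hp (le_refl θ₀) h0
    (N * μ₀ + (C + 1) * (N * h ^ 2))
  have hL := hb.logMoment_sub_le hs hN (a := 0) (b := h) (r := h) h0 (by linarith) le_rfl h1
  rw [add_zero] at hL
  refine le_trans ?_ (key.trans (Real.exp_le_exp.2 (by nlinarith)))
  have hu := (isProbWeight_sigmoid θ₀).prod (ι := Fin m)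
  rw [← hu.wexp_const (bulkExp _ _)]
  exact hu.wexp_mono fun s => hp.prod.prod.wexp_mono fun x =>
    ind_mono fun hX => hX.trans (bulkLpp_le_lpp (psum_nonneg s) (fun _ => le_rfl) m n)

/-- The parameters differ by 2h, so the Chernoff exponent is at most 8h - 2N h³; the rounding term
8h is below N h³ because 16h ≤ 1 ≤ N h³. -/
theorem SlopeBounds.boundary_lower_tail (hb : SlopeBounds l x y θ₀ μ₀ c C)
    (hs : NearSize N x y m n) (hp : IsProbWeight (bernWeight (Real.exp l))) (hN : 0 ≤ N)
    (h0 : 0 ≤ h) (h1 : 16 * h ≤ 1) (hNh : 1 ≤ N * h ^ 3) :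
    bernExp (Real.sigmoid (θ₀ + h)) (fun s : Fin m → Bool =>
      bernExp (Real.sigmoid (l - (θ₀ - h))) fun v : Fin n → Bool => bulkExp (Real.exp l)
        fun x : Fin m → Fin n → Bool =>
          ind (lpp (wt x) (psum s) (psum v) m n < N * μ₀ - N * h ^ 2)) ≤
      Real.exp (-(N * h ^ 3)) := by
  refine (wexp_lpp_lt hp (by linarith) _).trans (Real.exp_le_exp.2 ?_)
  have hL := hb.le_logMoment_sub hs hN (a := -h) (b := h) (r := 0) (by linarith) (by linarith)
    (by linarith) fun d _ _ => sq_nonneg d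
  rw [← sub_eq_add_neg] at hL
  nlinarith

theorem SlopeBounds.far_tail (hb : SlopeBounds l x y θ₀ μ₀ c C) (hs : NearSize N x y m n)
    (hp : IsProbWeight (bernWeight (Real.exp l))) (hN : 0 ≤ N)
    (h0 : 0 ≤ h) (h1 : 16 * h ≤ 1) {z : ℕ} (hz : (16 * C + 2) * (N * h) ≤ c * z) :
    bernExp (Real.sigmoid (θ₀ + h)) (fun s : Fin m → Bool => bulkExp (Real.exp l)
      fun x : Fin m → Fin n → Bool => ind (FarExit z (N * μ₀ - N * h ^ 2) s (wt x) n)) ≤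
      Real.exp (-(N * h ^ 3)) := by
  by_cases hzm : z ≤ m
  swap
  · refine (isProbWeight_sigmoid _).prod.wexp_le fun s => hp.prod.prod.wexp_le fun x => ?_
    rw [ind_of_not]
    · positivity
    · rintro ⟨y, hy, hzy, -⟩
      omega
  -- Each boundary step gains at most σ(θ₀+2h)h, while each removed column loses at least σ(θ₀+3h)h.
  -- The gap c h² per step, over z steps, pays for the 16C N h³ coming from the quadratic bound at
  -- distance 4h.
  refine (wexp_farExit hp (θ := θ₀ + 3 * h) (t := h) (by linarith) h0 _ hzm).trans ?_
  rw [one_sub_add_mul_exp, ← Real.exp_nat_mul, ← Real.exp_add]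
  refine Real.exp_le_exp.2 ?_
  have hL := hb.logMoment_sub_le hs hN (a := 3 * h) (b := 4 * h) (r := 4 * h) (by linarith)
    (by linarith) le_rfl (by linarith)
  have e1 := log_one_add_exp_sub_le (show θ₀ + h ≤ θ₀ + h + h by linarith)
  have e2 := le_log_one_add_exp_sub (show θ₀ + 3 * h ≤ θ₀ + 4 * h by linarith)
  have e3 := hb.increase (2 * h) (3 * h) (abs_le.2 ⟨by linarith, by linarith⟩)
    (abs_le.2 ⟨by linarith, by linarith⟩) (by linarith)
  rw [show θ₀ + h + h = θ₀ + 2 * h by ring] at e1 ⊢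
  rw [show θ₀ + 3 * h + h = θ₀ + 4 * h by ring]
  have hsub : ∀ θ, logMoment l (m - z) n θ =
      logMoment l m n θ - z * Real.log (1 + Real.exp θ) := fun θ => by
    simp only [logMoment, Nat.cast_sub hzm]
    ring
  rw [hsub, hsub]
  have hz0 : (0 : ℝ) ≤ z := Nat.cast_nonneg z
  have f1 := mul_le_mul_of_nonneg_left e1 hz0
  have f2 := mul_le_mul_of_nonneg_left e2 hz0
  have f3 := mul_le_mul_of_nonneg_left e3 (mul_nonneg hz0 h0)
  have f4 := mul_le_mul_of_nonneg_right hz (sq_nonneg h)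
  nlinarith

theorem SlopeBounds.horizontal_exit (hb : SlopeBounds l x y θ₀ μ₀ c C) (hs : NearSize N x y m n)
    (hp : IsProbWeight (bernWeight (Real.exp l))) (hN : 0 ≤ N) {R : ℝ} (hR : 2 ≤ R)
    (hcR : C + 3 ≤ c * (R - 1) ^ 2) (h0 : 0 ≤ h) (h1 : 16 * h ≤ 1) (hRh : R * h ≤ 1)
    (hNh : 1 ≤ N * h ^ 3) :
    bernExp (Real.sigmoid (θ₀ - R * h)) (fun s : Fin m → Bool =>
      bernExp (Real.sigmoid (l - (θ₀ - R * h))) fun v : Fin n → Bool => bulkExp (Real.exp l)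
        fun x : Fin m → Fin n → Bool => ind (lpp (wt x) (fun _ => 0) (psum v) m n <
          lpp (wt x) (psum s) (fun _ => 0) m n)) ≤ 3 * Real.exp (-(N * h ^ 3)) := by
  have hRh' : h ≤ (R - 1) * h := by nlinarith
  -- The level exceeds Nμ₀ by (C+1)N h², beyond the stationary slopes on [θ₀-h, θ₀]. On [θ₀-Rh,
  -- θ₀-(R-1)h] the slope is at least N(μ₀ + c(R-1)²h²) - 4, which in turn exceeds the level by the
  -- choice of R.
  refine (wexp_horizontal_exit hp (θ₁ := θ₀ - (R - 1) * h) (θ := θ₀ - h) (t := h)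
    (by nlinarith) (by linarith) h0 (N * (μ₀ + (C + 1) * h ^ 2))).trans ?_
  have hL := hb.logMoment_sub_le hs hN (a := -h) (b := 0) (r := h) (by linarith) le_rfl h0
    (by linarith)
  have hM := hb.le_logMoment_sub hs hN (a := -(R * h)) (b := -((R - 1) * h))
    (r := ((R - 1) * h) ^ 2) (by nlinarith) (by linarith) (by nlinarith) fun d _ hd =>
      sq_le_sq.2 (by rw [abs_of_nonneg (by linarith), abs_of_nonpos (by linarith)]; linarith)
  rw [← sub_eq_add_neg, add_zero] at hL
  rw [← sub_eq_add_neg, ← sub_eq_add_neg] at hM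
  rw [sub_add_cancel]
  have f1 : logMoment l m n θ₀ - logMoment l m n (θ₀ - h) -
      h * (N * (μ₀ + (C + 1) * h ^ 2)) ≤ -(N * h ^ 3) := by nlinarith
  have f2 : logMoment l m n (θ₀ - R * h) - logMoment l m n (θ₀ - (R - 1) * h) +
      (θ₀ - (R - 1) * h - (θ₀ - R * h)) * (N * (μ₀ + (C + 1) * h ^ 2)) ≤ -(N * h ^ 3) := by
    have e := mul_le_mul_of_nonneg_right hcR (by positivity : 0 ≤ N * h ^ 3)
    have e1 : -((R - 1) * h) - -(R * h) = h := by ring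
    have e2 : θ₀ - (R - 1) * h - (θ₀ - R * h) = h := by ring
    rw [e1] at hM
    rw [e2]
    nlinarith
  have g1 := Real.exp_le_exp.2 f1
  have g2 := Real.exp_le_exp.2 f2
  linarith

/-- The walks have parameters θ₀+h and θ₀-Rh, so with tilt h the log-moment per step is at most
(R+3)h². Over 2Z N h steps this totals 2(R+3)Z N h³, and the extra 1 in the threshold leaves -N h³.
-/
theorem SlopeBounds.near_tail (hb : SlopeBounds l x y θ₀ μ₀ c C) (hs : NearSize N x y m n)
    (hp : IsProbWeight (bernWeight (Real.exp l))) (hN : 0 ≤ N) {R Z : ℝ} (hR : 2 ≤ R)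
    (hcR : C + 3 ≤ c * (R - 1) ^ 2) (h0 : 0 ≤ h) (h1 : 16 * h ≤ 1) (hRh : R * h ≤ 1)
    (hNh : 1 ≤ N * h ^ 3) {z : ℕ} (hz : z ≤ 2 * Z * (N * h)) :
    bernExp (Real.sigmoid (θ₀ + h)) (fun s : Fin m → Bool => bulkExp (Real.exp l)
      fun x : Fin m → Fin n → Bool => ind (NearExit z (N * μ₀ - N * h ^ 2)
        ((2 * (R + 3) * Z + 1) * (N * h ^ 2)) s (wt x) n)) ≤ 4 * Real.exp (-(N * h ^ 3)) := by
  have hρ : (1 - Real.sigmoid (θ₀ + h) + Real.sigmoid (θ₀ + h) * Real.exp h) *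
      (1 - Real.sigmoid (θ₀ - R * h) + Real.sigmoid (θ₀ - R * h) * Real.exp (-h)) ≤
      Real.exp ((R + 3) * h ^ 2) := by
    rw [one_sub_add_mul_exp, one_sub_add_mul_exp, ← Real.exp_add]
    refine Real.exp_le_exp.2 ?_
    have e1 := log_one_add_exp_sub_le (show θ₀ + h ≤ θ₀ + h + h by linarith)
    have e2 := le_log_one_add_exp_sub (show θ₀ - R * h + -h ≤ θ₀ - R * h by linarith)
    have e3 := mul_le_mul_of_nonneg_left
      (sigmoid_sub_le (show θ₀ - R * h + -h ≤ θ₀ + h + h by nlinarith)) h0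
    nlinarith
  refine (wexp_nearExit hp (isProbWeight_sigmoid _) h0 (Real.one_le_exp (by positivity)) hρ z
    _ _).trans ?_
  have hbad := hb.horizontal_exit hs hp hN hR hcR h0 h1 hRh hNh
  have hexp : Real.exp ((R + 3) * h ^ 2) ^ z *
      Real.exp (-(h * ((2 * (R + 3) * Z + 1) * (N * h ^ 2)))) ≤ Real.exp (-(N * h ^ 3)) := by
    rw [← Real.exp_nat_mul, ← Real.exp_add]
    refine Real.exp_le_exp.2 ?_
    have := mul_le_mul_of_nonneg_right hz (by positivity : 0 ≤ (R + 3) * h ^ 2)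
    nlinarith
  linarith

end Estimates

/-! ### Two-sided deviations of the bulk passage time. -/

section Deviation

variable {l x y θ₀ μ₀ c C N : ℝ} {m n : ℕ}

/-- The lower tail of the bulk passage time. -/
theorem SlopeBounds.lower_tail (hb : SlopeBounds l x y θ₀ μ₀ c C)
    (hb' : SlopeBounds l y x (l - θ₀) μ₀ c C) (hp : IsProbWeight (bernWeight (Real.exp l))) :
    ∃ ε > 0, ∃ A > 0, ∀ (N h : ℝ) (m n : ℕ), NearSize N x y m n → 0 < h → h ≤ ε →
      1 ≤ N * h ^ 3 →
      bulkExp (Real.exp l) (fun w : Fin m → Fin n → Bool =>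
        ind (bulkLpp (wt w) m n < N * μ₀ - A * (N * h ^ 2))) ≤ 11 * Real.exp (-(N * h ^ 3)) := by
  have hc := hb.c_pos
  have hC := hb.C_pos
  -- Z N h separates near from far exits and matches the far-tail requirement. R puts the comparison
  -- parameter θ₀-Rh low enough for the vertical boundary to win.
  set Z := (16 * C + 2) / c with hZ
  have hZpos : 0 < Z := by positivity
  set R := (C + 3) / c + 2 with hR
  have hR2 : 2 ≤ R := by
    have : 0 < (C + 3) / c := by positivity
    linarith
  have hcR : C + 3 ≤ c * (R - 1) ^ 2 := by
    have h1 : c * (R - 1) = C + 3 + c := by rw [hR]; field_simp; ring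
    nlinarith
  -- The bound 1/16 absorbs rounding, 1/R keeps θ₀-Rh within the unit window of `SlopeBounds`, and Z
  -- gives h² ≤ Z, hence Z N h ≥ 1, so that the ceiling at most doubles the threshold.
  refine ⟨min (1 / 16) (min (1 / R) Z), by positivity, 2 * (R + 3) * Z + 2, by positivity,
    fun N h m n hs h0 hε hNh => ?_⟩
  have h1 : 16 * h ≤ 1 := by
    have := hε.trans (min_le_left _ _); linarith
  have hRh : R * h ≤ 1 := by
    have := (hε.trans (min_le_right _ _)).trans (min_le_left _ _)
    rw [le_div_iff₀ (by linarith)] at this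
    linarith
  have hZh : h ≤ Z := (hε.trans (min_le_right _ _)).trans (min_le_right _ _)
  have hN : 0 ≤ N := by
    by_contra hneg
    have : N * h ^ 3 ≤ 0 := mul_nonpos_of_nonpos_of_nonneg (not_le.1 hneg).le (by positivity)
    linarith
  have hZN : 1 ≤ Z * (N * h) := by
    have h2 : N * h ^ 3 ≤ N * h * Z := by
      have : h ^ 2 ≤ Z := by nlinarith
      calc N * h ^ 3 = N * h * h ^ 2 := by ring
        _ ≤ N * h * Z := mul_le_mul_of_nonneg_left this (by positivity)
    linarith
  set z := ⌈Z * (N * h)⌉₊ with hz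
  have hz1 : Z * (N * h) ≤ z := Nat.le_ceil _
  have hz2 : (z : ℝ) ≤ 2 * Z * (N * h) := by
    have := (Nat.ceil_lt_add_one (by positivity : 0 ≤ Z * (N * h))).le
    linarith
  have hz3 : (16 * C + 2) * (N * h) ≤ c * z := by
    have : (16 * C + 2) * (N * h) = c * (Z * (N * h)) := by rw [hZ]; field_simp
    rw [this]
    exact mul_le_mul_of_nonneg_left hz1 hc.le
  have key := wexp_bulkLpp_lt_le (m := m) (n := n) hp (isProbWeight_sigmoid (θ₀ + h))
    (isProbWeight_sigmoid (l - (θ₀ - h))) (N * μ₀ - N * h ^ 2)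
    ((2 * (R + 3) * Z + 1) * (N * h ^ 2)) z z
  have t1 := hb.boundary_lower_tail hs hp hN h0.le h1 hNh
  have t2 := hb.far_tail hs hp hN h0.le h1 hz3
  have t3 := hb.near_tail hs hp hN hR2 hcR h0.le h1 hRh hNh hz2
  have t4 := hb'.far_tail hs.swap hp hN h0.le h1 hz3
  have t5 := hb'.near_tail hs.swap hp hN hR2 hcR h0.le h1 hRh hNh hz2
  rw [show l - θ₀ + h = l - (θ₀ - h) by ring] at t4 t5
  have e : N * μ₀ - (2 * (R + 3) * Z + 2) * (N * h ^ 2) =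
      N * μ₀ - N * h ^ 2 - (2 * (R + 3) * Z + 1) * (N * h ^ 2) := by ring
  rw [e]
  linarith

/-- Two-sided deviation bound for the bulk passage time. -/
theorem SlopeBounds.deviation (hb : SlopeBounds l x y θ₀ μ₀ c C)
    (hb' : SlopeBounds l y x (l - θ₀) μ₀ c C) (hp : IsProbWeight (bernWeight (Real.exp l))) :
    ∃ ε > 0, ∃ A > 0, ∀ (N h : ℝ) (m n : ℕ), NearSize N x y m n → 0 < h → h ≤ ε →
      1 ≤ N * h ^ 3 →
      bulkExp (Real.exp l) (fun w : Fin m → Fin n → Bool =>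
        ind (A * (N * h ^ 2) ≤ |bulkLpp (wt w) m n - N * μ₀|)) ≤
          12 * Real.exp (-(N * h ^ 3)) := by
  obtain ⟨ε, hε, A, hA, H⟩ := hb.lower_tail hb' hp
  refine ⟨min ε 1, by positivity, A + (C + 1), by have := hb.C_pos; positivity,
    fun N h m n hs h0 hhε hNh => ?_⟩
  have hN : 0 < N := by
    by_contra hneg
    have : N * h ^ 3 ≤ 0 := mul_nonpos_of_nonpos_of_nonneg (not_lt.1 hneg) (by positivity)
    linarith
  have h1 := H N h m n hs h0 (hhε.trans (min_le_left _ _)) hNh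
  have h2 := hb.upper_tail hs hp hN.le h0.le (hhε.trans (min_le_right _ _))
  have h3 := add_le_add h1 h2
  rw [← wexp_add] at h3
  refine le_trans (hp.prod.prod.wexp_mono fun w => ?_) (h3.trans (by linarith))
  refine ind_le_of (add_nonneg (ind_nonneg _) (ind_nonneg _)) fun hdev => ?_
  have hC := hb.C_pos
  have p1 : 0 < A * (N * h ^ 2) := by positivity
  have p2 : 0 < (C + 1) * (N * h ^ 2) := by positivity
  rcases le_abs.1 hdev with hd | hd
  · have : N * μ₀ + (C + 1) * (N * h ^ 2) ≤ bulkLpp (wt w) m n := by linarith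
    rw [ind_of this]
    exact le_add_of_nonneg_left (ind_nonneg _)
  · have : bulkLpp (wt w) m n < N * μ₀ - A * (N * h ^ 2) := by linarith
    rw [ind_of this]
    exact le_add_of_nonneg_right (ind_nonneg _)

end Deviation

/-! ### The shape function as the minimal stationary slope. -/

section Shape

theorem exists_sigmoid_increase (θ₀ : ℝ) : ∃ c > 0, ∀ a b, |a| ≤ 1 → |b| ≤ 1 → a ≤ b →
    c * (b - a) ≤ Real.sigmoid (θ₀ + b) - Real.sigmoid (θ₀ + a) := by
  refine ⟨Real.sigmoid (θ₀ - 1) * (1 - Real.sigmoid (θ₀ + 1)),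
    mul_pos (Real.sigmoid_pos _) (sub_pos.2 (Real.sigmoid_lt_one _)), fun a b ha hb hab => ?_⟩
  have := le_slope_of_hasDerivAt (K := Real.sigmoid (θ₀ - 1) * (1 - Real.sigmoid (θ₀ + 1)))
    (show θ₀ + a ≤ θ₀ + b by linarith) Real.hasDerivAt_sigmoid fun t h1 h2 => by
      have h3 := (abs_le.1 ha).1
      have h4 := (abs_le.1 hb).2
      exact mul_le_mul (Real.sigmoid_le (by linarith))
        (sub_le_sub_left (Real.sigmoid_le (by linarith)) _)
        (sub_nonneg.2 (Real.sigmoid_le_one _)) (Real.sigmoid_nonneg _)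
  simpa using this

/-- The stationary slope exceeds the shape function by a square. -/
theorem slope_eq_gpp_add {p x y θ₀ : ℝ} (hp0 : 0 < p) (hp1 : p < 1) (hx : 0 < x) (hy : 0 < y)
    (hlow : p < y / x) (hup : y / x < p⁻¹)
    (hθ₀ : Real.sigmoid θ₀ = (Real.sqrt (p * y / x) - p) / (1 - p)) (θ : ℝ) :
    x * Real.sigmoid θ + y * Real.sigmoid (Real.log p - θ) = gpp p x y +
      x * (1 - p) * (Real.sigmoid θ - Real.sigmoid θ₀) ^ 2 / (p + (1 - p) * Real.sigmoid θ) := by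
  set r := Real.sqrt (p * y / x) with hr
  have hr2 : r ^ 2 = p * y / x := Real.sq_sqrt (by positivity)
  have hy' : y = x * r ^ 2 / p := by rw [hr2]; field_simp
  have h1p : 0 < 1 - p := by linarith
  have hsqrt : Real.sqrt (p * x * y) = x * r := by
    rw [show p * x * y = (x * r) ^ 2 by rw [mul_pow, hr2]; field_simp]
    exact Real.sqrt_sq (by positivity)
  have hg : gpp p x y = (2 * (x * r) - p * (y + x)) / (1 - p) := by
    unfold gpp
    rw [if_neg, if_pos, hsqrt]
    · rw [lt_div_iff₀ hx] at hlow; exact hlow.le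
    · rw [div_lt_iff₀ hx] at hup
      rw [not_le, lt_div_iff₀ hp0]
      calc y * p < p⁻¹ * x * p := mul_lt_mul_of_pos_right hup hp0
        _ = x := by field_simp
  have hu0 := Real.sigmoid_pos θ
  have hv : Real.sigmoid (Real.log p - θ) =
      p * (1 - Real.sigmoid θ) / (p + (1 - p) * Real.sigmoid θ) := by
    rw [one_sub_sigmoid, sigmoid_eq_div, sigmoid_eq_div, Real.exp_sub, Real.exp_log hp0]
    have := Real.exp_pos θ
    have h2 : p + (1 - p) * (Real.exp θ / (1 + Real.exp θ)) =
        (p + Real.exp θ) / (1 + Real.exp θ) := by field_simp; ring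
    rw [h2]
    field_simp
    ring
  rw [hg, hv, hθ₀, hy']
  have hρ : 0 < p + (1 - p) * Real.sigmoid θ := by positivity
  field_simp
  ring

/-- The condition p < y/x < 1/p puts √(py/x) strictly between p and 1, so the minimizing u is a
genuine Bernoulli parameter. The transposed bounds come from the symmetry θ ↦ log p - θ, which sends
d to -d. -/
theorem exists_slopeBounds {p x y : ℝ} (hp0 : 0 < p) (hp1 : p < 1) (hx : 0 < x) (hy : 0 < y)
    (hlow : p < y / x) (hup : y / x < p⁻¹) :
    ∃ θ₀ c C, SlopeBounds (Real.log p) x y θ₀ (gpp p x y) c C ∧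
      SlopeBounds (Real.log p) y x (Real.log p - θ₀) (gpp p x y) c C := by
  have h1p : 0 < 1 - p := by linarith
  set r := Real.sqrt (p * y / x) with hr
  have hr2 : r ^ 2 = p * y / x := Real.sq_sqrt (by positivity)
  have hr0 : 0 ≤ r := Real.sqrt_nonneg _
  have hrp : p < r := by
    refine lt_of_pow_lt_pow_left₀ 2 hr0 ?_
    rw [hr2, mul_div_assoc, sq]
    exact mul_lt_mul_of_pos_left hlow hp0
  have hr1 : r < 1 := by
    refine lt_of_pow_lt_pow_left₀ 2 zero_le_one ?_
    rw [hr2, mul_div_assoc, one_pow, ← mul_inv_cancel₀ hp0.ne']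
    exact mul_lt_mul_of_pos_left hup hp0
  obtain ⟨θ₀, hθ₀⟩ : ∃ θ₀, Real.sigmoid θ₀ = (r - p) / (1 - p) := by
    have : (r - p) / (1 - p) ∈ Set.range Real.sigmoid := by
      rw [Real.range_sigmoid]
      exact ⟨by apply div_pos <;> linarith, by rw [div_lt_one h1p]; linarith⟩
    exact this
  have hslope := slope_eq_gpp_add hp0 hp1 hx hy hlow hup hθ₀
  obtain ⟨c₁, hc₁, hinc₁⟩ := exists_sigmoid_increase θ₀
  obtain ⟨c₂, hc₂, hinc₂⟩ := exists_sigmoid_increase (Real.log p - θ₀)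
  have hxp : 0 < x * (1 - p) := by positivity
  -- The denominator p + (1-p)σ(θ) lies between p and 1: its upper bound serves the lower quadratic
  -- estimate, its lower bound gives the 1/p in C.
  set c := min (min c₁ c₂) (x * (1 - p) * c₁ ^ 2) with hc
  have hcpos : 0 < c := by positivity
  set C := x * (1 - p) / p with hC
  have hCpos : 0 < C := by positivity
  have hρ : ∀ θ, p ≤ p + (1 - p) * Real.sigmoid θ ∧ p + (1 - p) * Real.sigmoid θ ≤ 1 := fun θ => by
    constructor <;> nlinarith [Real.sigmoid_nonneg θ, Real.sigmoid_le_one θ]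
  have hlower : ∀ d, |d| ≤ 1 → gpp p x y + c * d ^ 2 ≤
      x * Real.sigmoid (θ₀ + d) + y * Real.sigmoid (Real.log p - (θ₀ + d)) := by
    intro d hd
    rw [hslope]
    refine add_le_add_right ?_ _
    have hsq : c₁ ^ 2 * d ^ 2 ≤ (Real.sigmoid (θ₀ + d) - Real.sigmoid θ₀) ^ 2 := by
      rw [← mul_pow]
      refine sq_le_sq.2 ?_
      rw [abs_mul, abs_of_pos hc₁]
      rcases le_total 0 d with h | h
      · have := hinc₁ 0 d (by simp) hd h
        rw [sub_zero, add_zero] at this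
        rw [abs_of_nonneg h]
        exact this.trans (le_abs_self _)
      · have := hinc₁ d 0 hd (by simp) h
        rw [zero_sub, add_zero] at this
        rw [abs_of_nonpos h, abs_sub_comm]
        exact this.trans (le_abs_self _)
    calc c * d ^ 2 ≤ x * (1 - p) * c₁ ^ 2 * d ^ 2 :=
          mul_le_mul_of_nonneg_right (min_le_right _ _) (sq_nonneg d)
      _ ≤ x * (1 - p) * (Real.sigmoid (θ₀ + d) - Real.sigmoid θ₀) ^ 2 := by
          rw [mul_assoc]; exact mul_le_mul_of_nonneg_left hsq hxp.le
      _ ≤ _ := le_div_self (by positivity) (hp0.trans_le (hρ _).1) (hρ _).2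
  have hupper : ∀ d, |d| ≤ 1 → x * Real.sigmoid (θ₀ + d) +
      y * Real.sigmoid (Real.log p - (θ₀ + d)) ≤ gpp p x y + C * d ^ 2 := by
    intro d _
    rw [hslope]
    refine add_le_add_right ?_ _
    have hsq : (Real.sigmoid (θ₀ + d) - Real.sigmoid θ₀) ^ 2 ≤ d ^ 2 := by
      refine sq_le_sq.2 ?_
      rcases le_total 0 d with h | h
      · have h1 := sigmoid_sub_le (show θ₀ ≤ θ₀ + d by linarith)
        have h2 := Real.sigmoid_le (show θ₀ ≤ θ₀ + d by linarith)
        rw [abs_of_nonneg h, abs_of_nonneg (by linarith)]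
        linarith
      · have h1 := sigmoid_sub_le (show θ₀ + d ≤ θ₀ by linarith)
        have h2 := Real.sigmoid_le (show θ₀ + d ≤ θ₀ by linarith)
        rw [abs_of_nonpos h, abs_of_nonpos (by linarith)]
        linarith
    calc _ ≤ x * (1 - p) * (Real.sigmoid (θ₀ + d) - Real.sigmoid θ₀) ^ 2 / p :=
          div_le_div_of_nonneg_left (by positivity) hp0 (hρ _).1
      _ ≤ x * (1 - p) * d ^ 2 / p := by gcongr
      _ = C * d ^ 2 := by rw [hC]; ring
  refine ⟨θ₀, c, C, ⟨hcpos, hCpos, hlower, hupper, fun a b ha hb hab => le_trans ?_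
    (hinc₁ a b ha hb hab)⟩, ⟨hcpos, hCpos, fun d hd => ?_, fun d hd => ?_,
      fun a b ha hb hab => le_trans ?_ (hinc₂ a b ha hb hab)⟩⟩
  · exact mul_le_mul_of_nonneg_right ((min_le_left _ _).trans (min_le_left _ _)) (by linarith)
  · have := hlower (-d) (by rwa [abs_neg])
    rw [neg_sq] at this
    rw [show Real.log p - (Real.log p - θ₀ + d) = θ₀ + -d by ring,
      show Real.log p - θ₀ + d = Real.log p - (θ₀ + -d) by ring]
    linarith
  · have := hupper (-d) (by rwa [abs_neg])
    rw [neg_sq] at this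
    rw [show Real.log p - (Real.log p - θ₀ + d) = θ₀ + -d by ring,
      show Real.log p - θ₀ + d = Real.log p - (θ₀ + -d) by ring]
    linarith
  · exact mul_le_mul_of_nonneg_right ((min_le_left _ _).trans (min_le_right _ _)) (by linarith)

end Shape

/-! ### From admissible paths to the recursion. -/

section Paths

/-- The weights of the sites strictly to the north-east of `(a, b)`. -/
def siteWeights (ω : Environment) (a b : ℕ) : ℕ → ℕ → ℝ := fun i j => ω (a + 1 + i, b + 1 + j)

theorem shiftCol_siteWeights (ω : Environment) (a b : ℕ) :
    shiftCol 1 (siteWeights ω a b) = siteWeights ω (a + 1) b := by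
  funext i j; simp only [shiftCol, siteWeights, add_assoc]

theorem shiftRow_siteWeights (ω : Environment) (a b : ℕ) :
    shiftRow 1 (siteWeights ω a b) = siteWeights ω a (b + 1) := by
  funext i j; simp only [shiftRow, siteWeights, add_assoc]

theorem bulkLpp_shiftCol_le (w : ℕ → ℕ → ℝ) (i j : ℕ) :
    bulkLpp (shiftCol 1 w) i j ≤ bulkLpp w (i + 1) j := by
  have := add_bulkLpp_le_lpp (w := w) (S := fun _ => 0) (V := fun _ => 0) monotone_const
    (fun _ => le_rfl) rfl 1 i j
  rwa [zero_add, add_comm 1 i] at this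

theorem bulkLpp_shiftRow_le (w : ℕ → ℕ → ℝ) (i j : ℕ) :
    bulkLpp (shiftRow 1 w) i j ≤ bulkLpp w i (j + 1) := by
  rw [bulkLpp_shiftRow_eq, ← bulkLpp_transpose (w := w)]
  exact bulkLpp_shiftCol_le _ j i

variable {ω : Environment}

theorem siteWeights_nonneg (hω : ∀ v, 0 ≤ ω v) (a b i j : ℕ) : 0 ≤ siteWeights ω a b i j := hω _

/-- A path is a list consumed from its head, so the induction moves the starting point and relies on
the recursion in the start, `bulkLpp_start`. -/
theorem IsAdmissiblePath.weight_le (hω : ∀ v, 0 ≤ ω v) {π : List Site} {a b c d : ℕ}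
    (h : IsAdmissiblePath (a, b) (c, d) π) :
    a ≤ c ∧ b ≤ d ∧ pathWeight ω π ≤ bulkLpp (siteWeights ω a b) (c - a) (d - b) := by
  induction π generalizing a b with
  | nil => simp [IsAdmissiblePath] at h
  | cons v l ih =>
    obtain ⟨h1, h2, h3⟩ := h
    obtain rfl : v = (a, b) := by simpa using h1
    cases l with
    | nil =>
      simp only [List.getLast?_singleton, Option.some.injEq, Prod.mk.injEq] at h2
      exact ⟨h2.1.le, h2.2.le, bulkLpp_nonneg _ _⟩
    | cons v' l =>
      rw [List.isChain_cons_cons] at h3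
      rw [List.getLast?_cons_cons] at h2
      obtain ⟨hstep, hchain⟩ := h3
      rw [pathWeight]
      rcases hstep with rfl | rfl | rfl
      · obtain ⟨i1, i2, i3⟩ := ih (a := a + 1) (b := b) ⟨rfl, h2, hchain⟩
        refine ⟨by omega, i2, ?_⟩
        have hw : stepWeight ω (a, b) ((a, b) + (1, 0)) = 0 := by simp [stepWeight]
        rw [hw, zero_add]
        refine i3.trans ?_
        have := bulkLpp_shiftCol_le (siteWeights ω a b) (c - (a + 1)) (d - b)
        rwa [shiftCol_siteWeights, show c - (a + 1) + 1 = c - a by omega] at this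
      · obtain ⟨i1, i2, i3⟩ := ih (a := a) (b := b + 1) ⟨rfl, h2, hchain⟩
        refine ⟨i1, by omega, ?_⟩
        have hw : stepWeight ω (a, b) ((a, b) + (0, 1)) = 0 := by simp [stepWeight]
        rw [hw, zero_add]
        refine i3.trans ?_
        have := bulkLpp_shiftRow_le (siteWeights ω a b) (c - a) (d - (b + 1))
        rwa [shiftRow_siteWeights, show d - (b + 1) + 1 = d - b by omega] at this
      · obtain ⟨i1, i2, i3⟩ := ih (a := a + 1) (b := b + 1) ⟨rfl, h2, hchain⟩
        refine ⟨by omega, by omega, ?_⟩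
        have hw : stepWeight ω (a, b) ((a, b) + (1, 1)) = siteWeights ω a b 0 0 := by
          simp [stepWeight, siteWeights]
        rw [hw, show c - a = c - (a + 1) + 1 by omega, show d - b = d - (b + 1) + 1 by omega,
          bulkLpp_start (siteWeights_nonneg hω a b), shiftRow_siteWeights,
          shiftCol_siteWeights, shiftCol_siteWeights, add_comm]
        exact le_max_of_le_right (add_le_add_left i3 _)

/-- The path is built by following a maximizing branch of `bulkLpp_start` at each site; steps that
collect nothing in the recursion are harmless because weights are nonnegative. -/
theorem exists_path_weight_ge (hω : ∀ v, 0 ≤ ω v) (m n a b : ℕ) :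
    ∃ π, IsAdmissiblePath (a, b) (a + m, b + n) π ∧
      bulkLpp (siteWeights ω a b) m n ≤ pathWeight ω π := by
  have hcons : ∀ (v v' t : Site) (r : ℝ), IsStep v v' →
      (∃ π, IsAdmissiblePath v' t π ∧ r ≤ pathWeight ω π) →
      ∃ π, IsAdmissiblePath v t π ∧ stepWeight ω v v' + r ≤ pathWeight ω π := by
    rintro v v' t r hs ⟨π, ⟨h1, h2, h3⟩, h4⟩
    cases π with
    | nil => simp at h1
    | cons u l =>
      obtain rfl : u = v' := by simpa using h1
      refine ⟨v :: u :: l, ⟨rfl, ?_, ?_⟩, ?_⟩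
      · rwa [List.getLast?_cons_cons]
      · exact List.isChain_cons_cons.2 ⟨hs, h3⟩
      · rw [pathWeight]
        linarith
  have hnonneg : ∀ v v', 0 ≤ stepWeight ω v v' := fun v v' => by
    unfold stepWeight; split_ifs
    · exact hω _
    · exact le_rfl
  have hweak : ∀ (v v' t : Site) (r : ℝ), IsStep v v' →
      (∃ π, IsAdmissiblePath v' t π ∧ r ≤ pathWeight ω π) →
      ∃ π, IsAdmissiblePath v t π ∧ r ≤ pathWeight ω π := by
    intro v v' t r hs h
    obtain ⟨π, h1, h2⟩ := hcons v v' t r hs h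
    exact ⟨π, h1, by linarith [hnonneg v v']⟩
  induction m generalizing n a b with
  | zero =>
    induction n generalizing b with
    | zero => exact ⟨[(a, b)], ⟨rfl, rfl, List.isChain_singleton _⟩, by simp [pathWeight]⟩
    | succ n ih =>
      have := ih (b + 1)
      rw [bulkLpp_zero_left, add_assoc, add_comm 1 n] at this
      rw [bulkLpp_zero_left]
      exact hweak _ _ _ _ (Or.inr (Or.inl rfl)) this
  | succ m ihm =>
    have hcol : ∀ n b, ∃ π, IsAdmissiblePath (a, b) (a + (m + 1), b + n) π ∧
        bulkLpp (siteWeights ω (a + 1) b) m n ≤ pathWeight ω π := fun n b => by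
      have := ihm n (a + 1) b
      rw [add_assoc a, add_comm 1 m] at this
      exact hweak _ _ _ _ (Or.inl rfl) this
    induction n generalizing b with
    | zero => simpa using hcol 0 b
    | succ n ihn =>
      rw [bulkLpp_start (siteWeights_nonneg hω a b), shiftCol_siteWeights, shiftRow_siteWeights,
        shiftCol_siteWeights]
      rcases max_choice (max (bulkLpp (siteWeights ω (a + 1) b) m (n + 1))
        (bulkLpp (siteWeights ω a (b + 1)) (m + 1) n))
        (bulkLpp (siteWeights ω (a + 1) (b + 1)) m n + siteWeights ω a b 0 0) with h | h <;> rw [h]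
      · rcases max_choice (bulkLpp (siteWeights ω (a + 1) b) m (n + 1))
          (bulkLpp (siteWeights ω a (b + 1)) (m + 1) n) with h | h <;> rw [h]
        · exact hcol (n + 1) b
        · have := ihn (b + 1)
          rw [add_assoc b, add_comm 1 n] at this
          exact hweak _ _ _ _ (Or.inr (Or.inl rfl)) this
      · have := ihm n (a + 1) (b + 1)
        rw [add_assoc a, add_comm 1 m, add_assoc b, add_comm 1 n] at this
        have h2 := hcons (a, b) _ _ _ (Or.inr (Or.inr rfl)) this
        have hw : stepWeight ω (a, b) ((a, b) + (1, 1)) = siteWeights ω a b 0 0 := by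
          simp [stepWeight, siteWeights]
        rwa [hw, add_comm (siteWeights ω a b 0 0)] at h2

theorem lastPassage_eq_bulkLpp (hω : ∀ v, 0 ≤ ω v) (m n a b : ℕ) :
    lastPassage (a, b) (a + m, b + n) ω = bulkLpp (siteWeights ω a b) m n := by
  have hle : ∀ π, IsAdmissiblePath (a, b) (a + m, b + n) π →
      pathWeight ω π ≤ bulkLpp (siteWeights ω a b) m n := fun π hπ => by
    simpa using (hπ.weight_le hω).2.2
  obtain ⟨π, hπ, hge⟩ := exists_path_weight_ge hω m n a b
  refine IsGreatest.csSup_eq ⟨⟨π, hπ, hge.antisymm (hle π hπ)⟩, ?_⟩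
  rintro s ⟨π', hπ', rfl⟩
  exact hle π' hπ'

end Paths

/-! ### From the infinite environment to finite rectangles of bits. -/

section Environment

variable (p : unitInterval)

instance : IsProbabilityMeasure (envMeasure p) := by
  unfold envMeasure; infer_instance

theorem ae_zero_or_one : ∀ᵐ ω ∂(envMeasure p), ∀ v, ω v = 0 ∨ ω v = 1 := by
  rw [ae_all_iff]
  intro v
  have hmp := measurePreserving_eval_infinitePi
    (fun _ : Site => ProbabilityTheory.bernoulliMeasure (1 : ℝ) (0 : ℝ) p) v
  have hae : ∀ᵐ t ∂(ProbabilityTheory.bernoulliMeasure (1 : ℝ) (0 : ℝ) p), t = 0 ∨ t = 1 := by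
    have hms : MeasurableSet {t : ℝ | t = 0 ∨ t = 1}ᶜ :=
      ((measurableSet_singleton (0 : ℝ)).union (measurableSet_singleton 1)).compl
    rw [ae_iff]
    have := ProbabilityTheory.bernoulliMeasure_apply (x := (1 : ℝ)) (y := (0 : ℝ)) p hms
    change ProbabilityTheory.bernoulliMeasure (1 : ℝ) (0 : ℝ) p {t : ℝ | t = 0 ∨ t = 1}ᶜ = 0
    rw [this]
    simp
  exact hmp.quasiMeasurePreserving.ae hae

/-- The bits of the environment in the rectangle of sites beyond `(1, 1)`. -/
noncomputable def readBits (m n : ℕ) (ω : Environment) : Fin m → Fin n → Bool :=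
  open Classical in fun i j => decide (ω (2 + i, 2 + j) = 1)

theorem measurable_readBits (m n : ℕ) : Measurable (readBits m n) := by
  refine measurable_pi_lambda _ fun i => measurable_pi_lambda _ fun j => ?_
  refine measurable_to_bool ?_
  have : (fun ω : Environment => readBits m n ω i j) ⁻¹' {true} =
      (fun ω : Environment => ω (2 + i, 2 + j)) ⁻¹' {1} := by
    ext ω; simp [readBits]
  rw [this]
  exact measurable_pi_apply _ (measurableSet_singleton 1)

theorem real_readBits_eq (m n : ℕ) (x : Fin m → Fin n → Bool) :
    (envMeasure p).real (readBits m n ⁻¹' {x}) = prodWeight (prodWeight (bernWeight p)) x := by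
  classical
  let e : Fin m × Fin n ↪ Site := ⟨fun k => (2 + k.1, 2 + k.2), fun k k' h => by
    simp only [Prod.mk.injEq, add_right_inj, Fin.val_inj] at h
    exact Prod.ext h.1 h.2⟩
  -- The family must be defined at every site, but only its values on the range of `e` matter, where
  -- subtracting 2 undoes the offset. The offset is 2 because a diagonal step from (1,1) first lands
  -- on (2,2).
  let t : Site → Set ℝ := fun v => if wt x (v.1 - 2) (v.2 - 2) = 1 then {1} else {1}ᶜ
  have ht : ∀ v, MeasurableSet (t v) := fun v => by
    simp only [t]; split_ifs
    · exact measurableSet_singleton 1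
    · exact (measurableSet_singleton 1).compl
  have hte : ∀ k : Fin m × Fin n, t (e k) = if x k.1 k.2 then {1} else {1}ᶜ := fun k => by
    have h1 : (e k).1 - 2 = k.1 := Nat.add_sub_cancel_left _ _
    have h2 : (e k).2 - 2 = k.2 := Nat.add_sub_cancel_left _ _
    simp only [t]
    rw [h1, h2]
    simp only [wt, k.1.2, k.2.2, and_self, dite_true, Fin.eta]
    cases x k.1 k.2 <;> simp [bval]
  have hset : readBits m n ⁻¹' {x} = Set.pi (Finset.univ.map e) t := by
    ext ω
    have h1 : ω ∈ Set.pi (Finset.univ.map e) t ↔ ∀ k, ω (e k) ∈ t (e k) :=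
      ⟨fun h k => h (e k) (by simp), fun h v hv => by
        obtain ⟨k, -, rfl⟩ := Finset.mem_map.1 hv
        exact h k⟩
    rw [h1, Prod.forall, Set.mem_preimage, Set.mem_singleton_iff, funext_iff]
    refine forall_congr' fun i => ?_
    rw [funext_iff]
    refine forall_congr' fun j => ?_
    rw [hte, show e (i, j) = (2 + (i : ℕ), 2 + (j : ℕ)) from rfl]
    simp only [readBits]
    cases x i j <;> simp
  rw [hset, envMeasure, measureReal_def, Measure.infinitePi_pi _ fun v _ => ht v,
    Finset.prod_map, ENNReal.toReal_prod, Fintype.prod_prod_type]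
  simp only [prodWeight]
  refine Finset.prod_congr rfl fun i _ => Finset.prod_congr rfl fun j _ => ?_
  rw [hte]
  have h1 := ProbabilityTheory.bernoulliMeasure_real_apply (x := (1 : ℝ)) (y := (0 : ℝ)) p
    (measurableSet_singleton (1 : ℝ))
  have h2 := ProbabilityTheory.bernoulliMeasure_real_apply (x := (1 : ℝ)) (y := (0 : ℝ)) p
    (measurableSet_singleton (1 : ℝ)).compl
  rw [measureReal_def] at h1 h2
  cases x i j
  · simp only [Bool.false_eq_true, if_false, h2]
    simp [bernWeight]
  · simp only [if_true, h1]
    simp [bernWeight]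

theorem integrable_readBits {m n : ℕ} (f : (Fin m → Fin n → Bool) → ℝ) :
    Integrable (fun ω => f (readBits m n ω)) (envMeasure p) := by
  have h : Integrable f ((envMeasure p).map (readBits m n)) := Integrable.of_finite
  exact h.comp_measurable (measurable_readBits m n)

theorem integral_readBits {m n : ℕ} (f : (Fin m → Fin n → Bool) → ℝ) :
    ∫ ω, f (readBits m n ω) ∂(envMeasure p) = bulkExp p f := by
  have hm := measurable_readBits m n
  rw [← integral_map hm.aemeasurable (measurable_of_finite f).aestronglyMeasurable,
    integral_fintype Integrable.of_finite]
  refine Finset.sum_congr rfl fun x _ => ?_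
  rw [map_measureReal_apply hm (measurableSet_singleton x), real_readBits_eq, smul_eq_mul]

theorem real_readBits_mem {m n : ℕ} (Q : (Fin m → Fin n → Bool) → Prop) :
    (envMeasure p).real {ω | Q (readBits m n ω)} = bulkExp p fun x => ind (Q x) := by
  have hm : MeasurableSet {ω | Q (readBits m n ω)} :=
    measurable_readBits m n (Set.toFinite {x | Q x}).measurableSet
  rw [← integral_readBits, ← integral_indicator_one hm]
  refine integral_congr_ae (Filter.Eventually.of_forall fun ω => ?_)
  by_cases h : Q (readBits m n ω) <;> simp [ind, h]

theorem bulkPassage_ae_eq {x y : ℝ} {N m n : ℕ} (hm : ⌊(N : ℝ) * x⌋₊ = 1 + m)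
    (hn : ⌊(N : ℝ) * y⌋₊ = 1 + n) : ∀ᵐ ω ∂(envMeasure p),
      bulkPassage x y N ω = bulkLpp (wt (readBits m n ω)) m n := by
  filter_upwards [ae_zero_or_one p] with ω hω
  have hpos : ∀ v, 0 ≤ ω v := fun v => by rcases hω v with h | h <;> simp [h]
  rw [bulkPassage, hm, hn, lastPassage_eq_bulkLpp hpos]
  refine bulkLpp_congr fun i hi j hj => ?_
  simp only [wt, hi, hj, and_self, dite_true, siteWeights, readBits]
  rcases hω (2 + i, 2 + j) with h | h <;> simp [h, bval]

end Environment

/-! ### Rescaling, uniform tails and moments. -/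

theorem exp_neg_cube_le {s : ℝ} (hs : 0 < s) : Real.exp (-s ^ 3) ≤ 2 / (s ^ 2) ^ 3 := by
  have h := Real.quadratic_le_exp_of_nonneg (by positivity : 0 ≤ s ^ 3)
  have h3 : 0 < s ^ 3 := by positivity
  rw [Real.exp_neg, inv_le_comm₀ (Real.exp_pos _) (by positivity), inv_div]
  calc (s ^ 2) ^ 3 / 2 = (s ^ 3) ^ 2 / 2 := by ring
    _ ≤ _ := by nlinarith

/-- One unit is lost to the floor and one to the starting point (1,1), which explains the 2 in
`NearSize`. -/
theorem nearSize_floor {N x y : ℝ} {m n : ℕ} (hx : 0 ≤ N * x) (hy : 0 ≤ N * y)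
    (hm : ⌊N * x⌋₊ = 1 + m) (hn : ⌊N * y⌋₊ = 1 + n) : NearSize N x y m n := by
  have h1 := Nat.floor_le hx
  have h2 := Nat.lt_floor_add_one (N * x)
  have h3 := Nat.floor_le hy
  have h4 := Nat.lt_floor_add_one (N * y)
  rw [hm] at h1 h2
  rw [hn] at h3 h4
  push_cast at h1 h2 h3 h4
  exact ⟨by linarith, by linarith, by linarith, by linarith⟩

/-- Cubic tail bound for the rescaled passage time. -/
theorem exists_tail_bound (p : unitInterval) (hp0 : 0 < (p : ℝ)) (hp1 : (p : ℝ) < 1)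
    (x y : ℝ) (hx : 0 < x) (hy : 0 < y) (hlow : (p : ℝ) < y / x) (hup : y / x < (p : ℝ)⁻¹) :
    ∃ B ≥ (1 : ℝ), ∃ K > 0, ∀ b ≥ B, ∀ (N : ℝ) (m n : ℕ), 0 < N → NearSize N x y m n →
      bulkExp p (fun w : Fin m → Fin n → Bool =>
        ind (b * N ^ (1 / 3 : ℝ) ≤ |bulkLpp (wt w) m n - N * gpp p x y|)) ≤ K / b ^ 3 := by
  obtain ⟨θ₀, c, C, hb, hb'⟩ := exists_slopeBounds hp0 hp1 hx hy hlow hup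
  have hexp : Real.exp (Real.log p) = p := Real.exp_log hp0
  have hpw : IsProbWeight (bernWeight (p : ℝ)) := isProbWeight_bern hp0.le hp1.le
  obtain ⟨ε, hε, A, hA, H⟩ := hb.deviation hb' (hexp.symm ▸ hpw)
  rw [hexp] at H
  set D := x + |gpp p x y| with hD
  have hDpos : 0 < D := by positivity
  -- With h² = κ b / N^{2/3}, the factor 1/A brings A N h² below b N^{1/3}, and ε²/D keeps h ≤ ε
  -- whenever b N^{1/3} ≤ D N. The threshold b ≥ 1/κ ensures N h³ = (κb)^{3/2} ≥ 1.
  set κ := min (1 / A) (ε ^ 2 / D) with hκ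
  have hκpos : 0 < κ := by positivity
  refine ⟨max 1 (1 / κ), le_max_left _ _, 24 / κ ^ 3, by positivity,
    fun b hbB N m n hN hs => ?_⟩
  have hb1 : 1 ≤ b := (le_max_left _ _).trans hbB
  have hκb : 1 ≤ κ * b := by
    have := (le_max_right _ _).trans hbB
    rw [div_le_iff₀ hκpos] at this
    linarith
  set q := N ^ (1 / 3 : ℝ) with hq
  have hqpos : 0 < q := Real.rpow_pos_of_pos hN _
  have hq3 : q ^ 3 = N := by
    rw [hq, ← Real.rpow_natCast, ← Real.rpow_mul hN.le]; norm_num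
  -- Beyond D N the event is empty, since the passage time lies between 0 and N x.
  by_cases hlarge : D * N < b * q
  · refine hpw.prod.prod.wexp_le fun w => ?_
    rw [ind_of_not]
    · positivity
    · intro hdev
      have h1 := bulkLpp_nonneg (w := wt w) m n
      have h2 := bulkLpp_le (wt_le_one w) m n
      have h3 := hs.fst_le
      have h4 : |bulkLpp (wt w) m n - N * gpp p x y| ≤ N * x + N * |gpp p x y| := by
        refine (abs_sub _ _).trans ?_
        rw [abs_of_nonneg h1, abs_mul, abs_of_pos hN]
        linarith
      rw [hD] at hlarge
      linarith
  · set s := Real.sqrt (κ * b) with hsdef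
    have hs2 : s ^ 2 = κ * b := Real.sq_sqrt (by positivity)
    have hs1 : 1 ≤ s := Real.one_le_sqrt.2 hκb
    have hspos : 0 < s := by linarith
    have hh2 : (s / q) ^ 2 ≤ ε ^ 2 := by
      rw [div_pow, hs2, div_le_iff₀ (by positivity)]
      have h1 : b ≤ D * q ^ 2 := by
        have : b * q ≤ D * q ^ 2 * q := by
          calc b * q ≤ D * N := not_lt.1 hlarge
            _ = D * q ^ 2 * q := by rw [← hq3]; ring
        exact le_of_mul_le_mul_right this hqpos
      calc κ * b ≤ ε ^ 2 / D * (D * q ^ 2) :=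
            mul_le_mul (min_le_right _ _) h1 (by positivity) (by positivity)
        _ = ε ^ 2 * q ^ 2 := by field_simp
    have hN3 : N * (s / q) ^ 3 = s ^ 3 := by rw [← hq3]; field_simp
    have hN2 : N * (s / q) ^ 2 = κ * b * q := by rw [← hq3, div_pow, hs2]; field_simp
    have key := H N (s / q) m n hs (by positivity)
      ((sq_le_sq₀ (by positivity) hε.le).1 hh2) (by rw [hN3]; exact one_le_pow₀ hs1)
    rw [hN3, hN2] at key
    have hAb : A * (κ * b * q) ≤ b * q := by
      have : A * κ ≤ 1 := by
        calc A * κ ≤ A * (1 / A) := mul_le_mul_of_nonneg_left (min_le_left _ _) hA.le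
          _ = 1 := by field_simp
      calc A * (κ * b * q) = A * κ * (b * q) := by ring
        _ ≤ 1 * (b * q) := mul_le_mul_of_nonneg_right this (by positivity)
        _ = b * q := one_mul _
    refine (hpw.prod.prod.wexp_mono fun w => ind_mono fun hdev => hAb.trans hdev).trans
      (key.trans ?_)
    calc 12 * Real.exp (-s ^ 3) ≤ 12 * (2 / (s ^ 2) ^ 3) := by
          gcongr; exact exp_neg_cube_le hspos
      _ = 24 / κ ^ 3 / b ^ 3 := by rw [hs2]; field_simp; norm_num

/-- A cubic tail bounds all moments of order less than three halves uniformly. -/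
theorem integral_rpow_le_of_tail {Ω : Type*} [MeasurableSpace Ω] {μ : Measure Ω}
    [IsProbabilityMeasure μ] {X : Ω → ℝ} {B K r : ℝ} (hB : 1 ≤ B) (hK : 0 < K) (hr1 : 1 ≤ r)
    (hr2 : r ≤ 2) (hX : ∀ ω, 0 ≤ X ω) (hint : Integrable (fun ω => X ω ^ r) μ)
    (htail : ∀ b ≥ B, μ.real {ω | b ≤ X ω} ≤ K / b ^ 3) :
    ∫ ω, X ω ^ r ∂μ ≤ ∫ t in Set.Ioi (0 : ℝ),
      (8 * K + (B ^ 2 + 1) ^ 2) * (t + 1) ^ (-(3 / 2) : ℝ) := by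
  rw [hint.integral_eq_integral_meas_le
    (Filter.Eventually.of_forall fun ω => Real.rpow_nonneg (hX ω) r)]
  refine integral_mono_of_nonneg (Filter.Eventually.of_forall fun t => measureReal_nonneg)
    ((integrableOn_add_rpow_Ioi_of_lt (by norm_num) (by norm_num)).const_mul _) ?_
  refine (ae_restrict_mem measurableSet_Ioi).mono fun t ht => ?_
  have ht0 : 0 < t := ht
  have ht1 : 0 < t + 1 := by linarith
  have hpos : 0 < (t + 1) ^ (-(3 / 2) : ℝ) := Real.rpow_pos_of_pos ht1 _
  change μ.real {ω | t ≤ X ω ^ r} ≤ _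
  -- For t ≥ B², r ≤ 2 makes X^r ≥ t imply X ≥ √t ≥ B, and the cubic tail at √t is of order
  -- t^{-3/2}, integrable at infinity. For smaller t the trivial bound 1 suffices.
  rcases le_total (B ^ 2) t with hBt | hBt
  · set b := Real.sqrt t with hb
    have hbB : B ≤ b := Real.le_sqrt_of_sq_le hBt
    have hb1 : 1 ≤ b := hB.trans hbB
    have hb2 : b ^ 2 = t := Real.sq_sqrt ht0.le
    have hsub : {ω | t ≤ X ω ^ r} ⊆ {ω | b ≤ X ω} := by
      intro ω (hω : t ≤ X ω ^ r)
      change b ≤ X ω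
      by_contra hlt
      have hlt : X ω < b := not_le.1 hlt
      have h1 : X ω ^ r < b ^ r := Real.rpow_lt_rpow (hX ω) hlt (by linarith)
      have h2 : b ^ r ≤ b ^ (2 : ℝ) := Real.rpow_le_rpow_of_exponent_le hb1 hr2
      rw [Real.rpow_two, hb2] at h2
      linarith
    have hb3 : b ^ 3 = t ^ (3 / 2 : ℝ) := by
      rw [hb, Real.sqrt_eq_rpow, ← Real.rpow_natCast, ← Real.rpow_mul ht0.le]
      norm_num
    have h2 : (t + 1) ^ (3 / 2 : ℝ) ≤ 8 * b ^ 3 := by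
      have ht1' : 1 ≤ t := (one_le_pow₀ hB).trans hBt
      calc (t + 1) ^ (3 / 2 : ℝ) ≤ (4 * t) ^ (3 / 2 : ℝ) :=
            Real.rpow_le_rpow ht1.le (by linarith) (by norm_num)
        _ = 8 * b ^ 3 := by
            rw [Real.mul_rpow (by norm_num) ht0.le, hb3]
            congr 1
            rw [show (4 : ℝ) = 2 ^ (2 : ℝ) by norm_num, ← Real.rpow_mul (by norm_num)]
            norm_num
    calc μ.real {ω | t ≤ X ω ^ r} ≤ μ.real {ω | b ≤ X ω} := measureReal_mono hsub
      _ ≤ K / b ^ 3 := htail b hbB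
      _ = 8 * K / (8 * b ^ 3) := by field_simp
      _ ≤ 8 * K / (t + 1) ^ (3 / 2 : ℝ) :=
          div_le_div_of_nonneg_left (by positivity) (Real.rpow_pos_of_pos ht1 _) h2
      _ = 8 * K * (t + 1) ^ (-(3 / 2) : ℝ) := by rw [Real.rpow_neg ht1.le, div_eq_mul_inv]
      _ ≤ _ := mul_le_mul_of_nonneg_right (le_add_of_nonneg_right (by positivity)) hpos.le
  · have h1 : 1 ≤ (B ^ 2 + 1) ^ 2 * (t + 1) ^ (-(3 / 2) : ℝ) := by
      rw [Real.rpow_neg ht1.le, ← div_eq_mul_inv, one_le_div (Real.rpow_pos_of_pos ht1 _)]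
      calc (t + 1) ^ (3 / 2 : ℝ) ≤ (t + 1) ^ (2 : ℝ) :=
            Real.rpow_le_rpow_of_exponent_le (by linarith) (by norm_num)
        _ = (t + 1) ^ 2 := Real.rpow_two _
        _ ≤ (B ^ 2 + 1) ^ 2 := by gcongr
    calc μ.real {ω | t ≤ X ω ^ r} ≤ 1 := measureReal_le_one
      _ ≤ _ := h1
      _ ≤ _ := mul_le_mul_of_nonneg_right (le_add_of_nonneg_left (by positivity)) hpos.le

theorem theorem5 (p : unitInterval) (hp0 : 0 < (p : ℝ)) (hp1 : (p : ℝ) < 1)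
    (x y : ℝ) (hx : 0 < x) (hy : 0 < y) (hlow : (p : ℝ) < y / x) (hup : y / x < (p : ℝ)⁻¹) :
    ∃ (N₀ : ℕ) (C : ℝ), 0 < C ∧
      (∀ b : ℝ, C ≤ b → ∀ N : ℕ, N₀ ≤ N → ∀ α : ℝ, 0 < α → α < 1 →
        (envMeasure p).real
            {ω | b * (N : ℝ) ^ (1 / 3 : ℝ) ≤ |bulkPassage x y N ω - N * gpp p x y|}
          ≤ C * b ^ (-(3 * α / 2))) ∧
      (∀ r : ℝ, 1 ≤ r → ∃ C' : ℝ, ∀ α : ℝ, 0 < α → α < 1 → r < 3 * α / 2 →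
        ∀ N : ℕ, N₀ < N →
          Integrable (fun ω => |(bulkPassage x y N ω - N * gpp p x y) / (N : ℝ) ^ (1 / 3 : ℝ)| ^ r)
              (envMeasure p) ∧
            ∫ ω, |(bulkPassage x y N ω - N * gpp p x y) / (N : ℝ) ^ (1 / 3 : ℝ)| ^ r
                ∂(envMeasure p) ≤ C') := by
  obtain ⟨B, hB, K, hK, H⟩ := exists_tail_bound p hp0 hp1 x y hx hy hlow hup
  -- Both floors are then at least 1, so the endpoint is reachable from (1,1).
  set N₀ := max 1 (max ⌈1 / x⌉₊ ⌈1 / y⌉₊) with hN₀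
  have hsize : ∀ N : ℕ, N₀ ≤ N → (0 : ℝ) < N ∧ ∃ m n : ℕ, ⌊(N : ℝ) * x⌋₊ = 1 + m ∧
      ⌊(N : ℝ) * y⌋₊ = 1 + n ∧ NearSize N x y m n := by
    intro N hN
    have h0 : (0 : ℝ) < N := by
      have : 1 ≤ N := (le_max_left _ _).trans hN
      exact_mod_cast this
    have hfloor : ∀ z : ℝ, 0 < z → ⌈1 / z⌉₊ ≤ N → 1 ≤ ⌊(N : ℝ) * z⌋₊ := fun z hz h => by
      rw [Nat.one_le_floor_iff, ← div_le_iff₀ hz]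
      exact (Nat.le_ceil _).trans (by exact_mod_cast h)
    obtain ⟨m, hm⟩ := Nat.exists_eq_add_of_le (hfloor x hx
      ((le_max_left _ _).trans ((le_max_right _ _).trans hN)))
    obtain ⟨n, hn⟩ := Nat.exists_eq_add_of_le (hfloor y hy
      ((le_max_right _ _).trans ((le_max_right _ _).trans hN)))
    exact ⟨h0, m, n, hm, hn, nearSize_floor (by positivity) (by positivity) hm hn⟩
  have htail : ∀ N : ℕ, N₀ ≤ N → ∀ b ≥ B, (envMeasure p).real
      {ω | b * (N : ℝ) ^ (1 / 3 : ℝ) ≤ |bulkPassage x y N ω - N * gpp p x y|} ≤ K / b ^ 3 := by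
    intro N hN b hb
    obtain ⟨h0, m, n, hm, hn, hs⟩ := hsize N hN
    refine le_trans (le_of_eq ?_) (H b hb N m n h0 hs)
    rw [← real_readBits_mem]
    refine measureReal_congr ?_
    filter_upwards [bulkPassage_ae_eq p hm hn] with ω hω
    change (_ ≤ _) = (_ ≤ _)
    rw [hω]
  refine ⟨N₀, max B K, by positivity, fun b hb N hN α hα0 hα1 => ?_, fun r hr => ?_⟩
  · have hbB : B ≤ b := (le_max_left _ _).trans hb
    have hb1 : 1 ≤ b := hB.trans hbB
    have hbpos : 0 < b := by linarith
    refine (htail N hN b hbB).trans ?_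
    -- The cubic tail is stronger than needed: b ≥ 1 and 3α/2 < 3.
    have h3 : b ^ (-3 : ℝ) ≤ b ^ (-(3 * α / 2)) :=
      Real.rpow_le_rpow_of_exponent_le hb1 (by linarith)
    have h4 : K / b ^ 3 = K * b ^ (-3 : ℝ) := by
      rw [Real.rpow_neg hbpos.le, div_eq_mul_inv]
      norm_num
    rw [h4]
    exact mul_le_mul (le_max_right _ _) h3 (by positivity) (by positivity)
  · refine ⟨∫ t in Set.Ioi (0 : ℝ), (8 * K + (B ^ 2 + 1) ^ 2) * (t + 1) ^ (-(3 / 2) : ℝ),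
      fun α hα0 hα1 hrα N hN => ?_⟩
    obtain ⟨h0, m, n, hm, hn, hs⟩ := hsize N hN.le
    have hint : Integrable (fun ω =>
        |(bulkPassage x y N ω - N * gpp p x y) / (N : ℝ) ^ (1 / 3 : ℝ)| ^ r) (envMeasure p) := by
      refine (integrable_readBits p (m := m) (n := n) fun w =>
        |(bulkLpp (wt w) m n - N * gpp p x y) / (N : ℝ) ^ (1 / 3 : ℝ)| ^ r).congr ?_
      filter_upwards [bulkPassage_ae_eq p hm hn] with ω hω
      rw [hω]
    refine ⟨hint, integral_rpow_le_of_tail hB hK hr (by linarith) (fun ω => abs_nonneg _) hint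
      fun b hb => ?_⟩
    have hq : 0 < (N : ℝ) ^ (1 / 3 : ℝ) := Real.rpow_pos_of_pos h0 _
    refine le_trans (le_of_eq ?_) (htail N hN.le b hb)
    congr 1
    ext ω
    simp only [Set.mem_ofPred_eq]
    rw [abs_div, abs_of_pos hq, le_div_iff₀ hq]
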